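/- **Setting.** Fix a separable infinite-dimensional complex Hilbert space $L$ and a unitary isomorphism $\iota : L\,\widehat\otimes\,L \to L$, where $L\,\widehat\otimes\,L$ is the Hilbert tensor product. Let $\mathcal B$ be the algebra of bounded operators on $L$ and $\mathcal K\subset\mathcal B$ the (non-closed) ideal of finite rank operators; for $a,b\in\mathcal B$ put $a\diamond b := \iota(a\,\widehat\otimes\,b)\iota^{-1}$. For a complex linear space $E$ put $\mathcal K E := \mathcal K\otimes E$ (algebraic tensor product); it is a $\mathcal B$-bimodule via $a\cdot(c\otimes x)\cdot b=(acb)\otimes x$. A *PQ-space* is a linear space $E$ together with a norm on $\mathcal K E$ satisfying $\|a\cdot u\cdot b\|\le\|a\|\|u\|\|b\|$ for $a,b\in\mathcal B$, $u\in\mathcal K E$. It is regarded as a normed space with the underlying norm $\|x\| := \|Q\otimes x\|$, where $Q$ is any operator of rank one and norm one (the choice does not matter). A linear map $\varphi:E\to F$ between PQ-spaces is a *complete isometry* if its amplification $\varphi_\infty:\mathcal K E\to\mathcal K F$, $a\otimes x\mapsto a\otimes\varphi(x)$, is isometric. For PQ-spaces $E,F$ and $u\in\mathcal KE$, $v\in\mathcal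 KF$ let $u\diamond v\in\mathcal K(E\otimes F)$ be given bilinearly by $(a\otimes x)\diamond(b\otimes y)=(a\diamond b)\otimes(x\otimes y)$. The PQ-space $E\otimes_{pop}F$ is the algebraic tensor product $E\otimes F$ with the norm $$\|U\|_{pop}=\inf\Big\{\sum_{k=1}^n\|a_k\|\|u_k\|\|v_k\|\|b_k\| \;:\; U=\sum_{k=1}^n a_k\cdot(u_k\diamond v_k)\cdot b_k,\ a_k,b_k\in\mathcal B,\ u_k\in\mathcal KE,\ v_k\in\mathcal KF\Big\}$$ on $\mathcal K(E\otimes F)$; it is not completed. For a measure space $(X,\mu)$ and a PQ-space $E$, let $L_1(X,E)$ be the normed space of (classes of) strongly measurable, norm-integrable functions $X\to E$. It is a PQ-space with the norm $\|u\|:=\|\alpha(u)\|$ for $u\in\mathcal K(L_1(X,E))$, where $\alpha:\mathcal K(L_1(X,E))\to L_1(X,\mathcal KE)$ takes $a\otimes x$ to the function $t\mapsto a\otimes x(t)$. **Theorem.** Let $(X,\mu)$, $(Y,\nu)$ be measure spaces, and let $X\times Y$ carry a product measure $\rho$ of $\mu$ and $\nu$, i.e. a measure on the product $\sigma$-algebra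 with $\rho(A\times B)=\mu(A)\nu(B)$ (with $0\cdot\infty=0$) for all measurable $A\subseteq X$, $B\subseteq Y$. Let $E$, $F$ be PQ-spaces. Then there is a unique linear map $$I: L_1(X,E)\otimes_{pop}L_1(Y,F)\to L_1(X\times Y,\,E\otimes_{pop}F)$$ such that, for all $\bar x\in L_1(X,E)$ and $\bar y\in L_1(Y,F)$, one has $I(\bar x\otimes\bar y)(s,t)=\bar x(s)\otimes\bar y(t)$ for $\rho$-almost all $(s,t)$, and this $I$ is a complete isometry. -/

import Mathlib

open MeasureTheory TensorProduct
open scoped ENNReal InnerProductSpace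

namespace ProtoQuantum

set_option linter.unusedSectionVars false

noncomputable section

section Hilbert

variable {H : Type*} [NormedAddCommGroup H] [InnerProductSpace ℂ H]

/-- The Hilbert tensor product `H ⊗̂ H`: the completion of the algebraic tensor product for the
inner product `⟪ξ ⊗ η, ξ' ⊗ η'⟫ = ⟪ξ, ξ'⟫ ⟪η, η'⟫`. -/
abbrev HilbertSquare (H : Type*) [NormedAddCommGroup H] [InnerProductSpace ℂ H] : Type _ :=
  UniformSpace.Completion (H ⊗[ℂ] H)

lemma exists_orthonormal_repr (z : H ⊗[ℂ] H) :
    ∃ (n : ℕ) (x e : Fin n → H), Orthonormal ℂ e ∧ z = ∑ i, x i ⊗ₜ[ℂ] e i := by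
  obtain ⟨F', hF, hz⟩ :=
    TensorProduct.exists_finite_submodule_right_of_setFinite {z} (Set.finite_singleton z)
  have hz' : z ∈ LinearMap.range (F'.subtype.lTensor H) := hz (Set.mem_singleton z)
  obtain ⟨w, rfl⟩ := hz'
  have : FiniteDimensional ℂ F' := hF
  let b := stdOrthonormalBasis ℂ F'
  have key : ∀ w : H ⊗[ℂ] F', ∃ x : Fin (Module.finrank ℂ F') → H, w = ∑ i, x i ⊗ₜ[ℂ] b i := by
    intro w
    induction w with
    | zero => exact ⟨0, by simp⟩
    | tmul x y =>
      refine ⟨fun i => b.repr y i • x, ?_⟩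
      conv_lhs => rw [← b.sum_repr y, TensorProduct.tmul_sum]
      simp [TensorProduct.smul_tmul]
    | add w₁ w₂ h₁ h₂ =>
      obtain ⟨x, rfl⟩ := h₁
      obtain ⟨y, rfl⟩ := h₂
      exact ⟨x + y, by simp [TensorProduct.add_tmul, Finset.sum_add_distrib]⟩
  obtain ⟨x, rfl⟩ := key w
  refine ⟨_, x, fun i => (b i : H), ?_, by simp⟩
  exact b.orthonormal.comp_linearIsometry F'.subtypeₗᵢ

lemma norm_sq_sum_tmul {n : ℕ} (x e : Fin n → H) (he : Orthonormal ℂ e) :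
    ‖∑ i, x i ⊗ₜ[ℂ] e i‖ ^ 2 = ∑ i, ‖x i‖ ^ 2 := by
  classical
  have h := inner_self_eq_norm_sq_to_K (𝕜 := ℂ) (∑ i, x i ⊗ₜ[ℂ] e i)
  rw [sum_inner] at h
  simp only [inner_sum, TensorProduct.inner_tmul, orthonormal_iff_ite.mp he] at h
  simp only [mul_ite, mul_one, mul_zero, Finset.sum_ite_eq, Finset.mem_univ, if_true,
    inner_self_eq_norm_sq_to_K] at h
  norm_cast at h
  exact_mod_cast h.symm

lemma norm_rTensor_le (a : H →L[ℂ] H) (z : H ⊗[ℂ] H) :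
    ‖TensorProduct.map a.toLinearMap LinearMap.id z‖ ≤ ‖a‖ * ‖z‖ := by
  obtain ⟨n, x, e, he, rfl⟩ := exists_orthonormal_repr z
  refine le_of_sq_le_sq ?_ (by positivity)
  have : TensorProduct.map a.toLinearMap LinearMap.id (∑ i, x i ⊗ₜ[ℂ] e i)
      = ∑ i, (a (x i)) ⊗ₜ[ℂ] e i := by simp
  rw [this, mul_pow, norm_sq_sum_tmul _ _ he, norm_sq_sum_tmul _ _ he, Finset.mul_sum]
  refine Finset.sum_le_sum fun i _ => ?_
  rw [← mul_pow]
  gcongr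
  exact a.le_opNorm _

lemma norm_map_le (a b : H →L[ℂ] H) (z : H ⊗[ℂ] H) :
    ‖TensorProduct.map a.toLinearMap b.toLinearMap z‖ ≤ ‖a‖ * ‖b‖ * ‖z‖ := by
  have h : TensorProduct.map a.toLinearMap b.toLinearMap z
      = TensorProduct.map a.toLinearMap LinearMap.id (TensorProduct.comm ℂ H H
        (TensorProduct.map b.toLinearMap LinearMap.id (TensorProduct.comm ℂ H H z))) := by
    induction z with
    | zero => simp
    | tmul x y => simp
    | add x y hx hy => simp only [map_add, hx, hy]
  rw [h, mul_assoc]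
  refine (norm_rTensor_le _ _).trans ?_
  gcongr
  rw [TensorProduct.norm_comm]
  refine (norm_rTensor_le _ _).trans ?_
  rw [TensorProduct.norm_comm]

/-- The Hilbert tensor product `a ⊗̂ b` of two bounded operators: the continuous extension of the
algebraic tensor product of `a` and `b`. -/
def hilbertTensor (a b : H →L[ℂ] H) : HilbertSquare H →L[ℂ] HilbertSquare H :=
  ((TensorProduct.map a.toLinearMap b.toLinearMap).mkContinuous (‖a‖ * ‖b‖)
    (norm_map_le a b)).completion

lemma hilbertTensor_coe (a b : H →L[ℂ] H) (z : H ⊗[ℂ] H) :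
    hilbertTensor a b (z : HilbertSquare H)
      = (TensorProduct.map a.toLinearMap b.toLinearMap z : H ⊗[ℂ] H) := by
  simp [hilbertTensor]

lemma norm_hilbertTensor_le (a b : H →L[ℂ] H) : ‖hilbertTensor a b‖ ≤ ‖a‖ * ‖b‖ := by
  refine ContinuousLinearMap.opNorm_le_bound _ (by positivity) fun z => ?_
  induction z using UniformSpace.Completion.induction_on with
  | hp => exact isClosed_le (by fun_prop) (by fun_prop)
  | ih z =>
    rw [hilbertTensor_coe, UniformSpace.Completion.norm_coe, UniformSpace.Completion.norm_coe]
    exact norm_map_le a b z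

/-- Two bounded operators on the Hilbert square that agree on elementary tensors are equal. -/
lemma hilbertSquare_ext {G : Type*} [NormedAddCommGroup G] [NormedSpace ℂ G]
    {S T : HilbertSquare H →L[ℂ] G}
    (h : ∀ ξ η : H, S ((ξ ⊗ₜ[ℂ] η : H ⊗[ℂ] H) : HilbertSquare H)
      = T ((ξ ⊗ₜ[ℂ] η : H ⊗[ℂ] H) : HilbertSquare H)) : S = T := by
  refine ContinuousLinearMap.ext fun z => ?_
  induction z using UniformSpace.Completion.induction_on with
  | hp => exact isClosed_eq (by fun_prop) (by fun_prop)
  | ih z =>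
    induction z with
    | zero => rw [UniformSpace.Completion.coe_zero, map_zero, map_zero]
    | tmul ξ η => exact h ξ η
    | add x y hx hy => rw [UniformSpace.Completion.coe_add, map_add, map_add, hx, hy]

/-- The vector `ξ ◇ η = ι (ξ ⊗ η)`. -/
def vecDia (ι : HilbertSquare H ≃ₗᵢ[ℂ] H) (ξ η : H) : H :=
  ι ((ξ ⊗ₜ[ℂ] η : H ⊗[ℂ] H) : HilbertSquare H)

/-- The operator `a ◇ b = ι (a ⊗̂ b) ι⁻¹`. -/
def opDia (ι : HilbertSquare H ≃ₗᵢ[ℂ] H) (a b : H →L[ℂ] H) : H →L[ℂ] H :=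
  (ι : HilbertSquare H →L[ℂ] H) ∘L hilbertTensor a b ∘L (ι.symm : H →L[ℂ] HilbertSquare H)

variable (ι : HilbertSquare H ≃ₗᵢ[ℂ] H)

lemma opDia_vecDia (a b : H →L[ℂ] H) (ξ η : H) :
    opDia ι a b (vecDia ι ξ η) = vecDia ι (a ξ) (b η) := by
  simp [opDia, vecDia, hilbertTensor_coe]

lemma vecDia_ext {S T : H →L[ℂ] H} (h : ∀ ξ η, S (vecDia ι ξ η) = T (vecDia ι ξ η)) : S = T := by
  have h2 : S ∘L (ι : HilbertSquare H →L[ℂ] H) = T ∘L (ι : HilbertSquare H →L[ℂ] H) :=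
    hilbertSquare_ext fun ξ η => h ξ η
  ext z
  have := DFunLike.congr_fun h2 (ι.symm z)
  simpa using this

lemma inner_vecDia (ξ η ξ' η' : H) :
    ⟪vecDia ι ξ η, vecDia ι ξ' η'⟫_ℂ = ⟪ξ, ξ'⟫_ℂ * ⟪η, η'⟫_ℂ := by
  simp [vecDia, LinearIsometryEquiv.inner_map_map]

lemma norm_vecDia (ξ η : H) : ‖vecDia ι ξ η‖ = ‖ξ‖ * ‖η‖ := by
  simp [vecDia]

lemma vecDia_add_left (ξ ξ' η : H) : vecDia ι (ξ + ξ') η = vecDia ι ξ η + vecDia ι ξ' η := by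
  simp [vecDia, TensorProduct.add_tmul, UniformSpace.Completion.coe_add]

lemma vecDia_add_right (ξ η η' : H) : vecDia ι ξ (η + η') = vecDia ι ξ η + vecDia ι ξ η' := by
  simp [vecDia, TensorProduct.tmul_add, UniformSpace.Completion.coe_add]

lemma vecDia_smul_left (c : ℂ) (ξ η : H) : vecDia ι (c • ξ) η = c • vecDia ι ξ η := by
  simp [vecDia, ← TensorProduct.smul_tmul', UniformSpace.Completion.coe_smul]

lemma vecDia_smul_right (c : ℂ) (ξ η : H) : vecDia ι ξ (c • η) = c • vecDia ι ξ η := by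
  simp [vecDia, UniformSpace.Completion.coe_smul]

lemma opDia_add_left (a a' b : H →L[ℂ] H) : opDia ι (a + a') b = opDia ι a b + opDia ι a' b :=
  vecDia_ext ι fun ξ η => by simp [opDia_vecDia, vecDia_add_left]

lemma opDia_add_right (a b b' : H →L[ℂ] H) : opDia ι a (b + b') = opDia ι a b + opDia ι a b' :=
  vecDia_ext ι fun ξ η => by simp [opDia_vecDia, vecDia_add_right]

lemma opDia_smul_left (c : ℂ) (a b : H →L[ℂ] H) : opDia ι (c • a) b = c • opDia ι a b :=
  vecDia_ext ι fun ξ η => by simp [opDia_vecDia, vecDia_smul_left]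

lemma opDia_smul_right (c : ℂ) (a b : H →L[ℂ] H) : opDia ι a (c • b) = c • opDia ι a b :=
  vecDia_ext ι fun ξ η => by simp [opDia_vecDia, vecDia_smul_right]

lemma norm_opDia_le (a b : H →L[ℂ] H) : ‖opDia ι a b‖ ≤ ‖a‖ * ‖b‖ := by
  refine ContinuousLinearMap.opNorm_le_bound _ (by positivity) fun z => ?_
  have h := (hilbertTensor a b).le_opNorm (ι.symm z)
  rw [ι.symm.norm_map] at h
  have h2 : ‖opDia ι a b z‖ = ‖hilbertTensor a b (ι.symm z)‖ := by simp [opDia]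
  rw [h2]
  exact h.trans (by gcongr; exact norm_hilbertTensor_le a b)

lemma opDia_rankOne (ξ η ξ' η' : H) :
    opDia ι (InnerProductSpace.rankOne ℂ ξ η) (InnerProductSpace.rankOne ℂ ξ' η')
      = InnerProductSpace.rankOne ℂ (vecDia ι ξ ξ') (vecDia ι η η') :=
  vecDia_ext ι fun z w => by
    simp [opDia_vecDia, vecDia_smul_left, vecDia_smul_right, inner_vecDia, smul_smul, mul_comm]

/-- The two-sided ideal `𝒦` of bounded operators of finite rank. -/
def finRank (H : Type*) [NormedAddCommGroup H] [InnerProductSpace ℂ H] :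
    Submodule ℂ (H →L[ℂ] H) where
  carrier := {a | FiniteDimensional ℂ (LinearMap.range a.toLinearMap)}
  zero_mem' := by
    change FiniteDimensional ℂ (LinearMap.range (0 : H →ₗ[ℂ] H))
    rw [LinearMap.range_zero]
    infer_instance
  add_mem' := by
    intro a b ha hb
    have : FiniteDimensional ℂ (LinearMap.range a.toLinearMap) := ha
    have : FiniteDimensional ℂ (LinearMap.range b.toLinearMap) := hb
    refine Submodule.finiteDimensional_of_le (S₂ := LinearMap.range a.toLinearMap ⊔
      LinearMap.range b.toLinearMap) ?_
    rintro _ ⟨x, rfl⟩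
    exact Submodule.add_mem_sup ⟨x, rfl⟩ ⟨x, rfl⟩
  smul_mem' := by
    intro c a ha
    have : FiniteDimensional ℂ (LinearMap.range a.toLinearMap) := ha
    refine Submodule.finiteDimensional_of_le (S₂ := LinearMap.range a.toLinearMap) ?_
    rintro _ ⟨x, rfl⟩
    exact ⟨c • x, by simp⟩

lemma rankOne_mem (ξ η : H) : InnerProductSpace.rankOne ℂ ξ η ∈ finRank H := by
  change FiniteDimensional ℂ _
  refine Submodule.finiteDimensional_of_le (S₂ := ℂ ∙ ξ) ?_
  rintro _ ⟨x, rfl⟩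
  exact Submodule.mem_span_singleton.mpr ⟨_, (InnerProductSpace.rankOne_apply ξ η x).symm⟩

/-- `ξ ∘ η`, the operator `ζ ↦ ⟪ζ, η⟫ ξ`, as an element of `𝒦`. -/
def circ (ξ η : H) : finRank H := ⟨InnerProductSpace.rankOne ℂ ξ η, rankOne_mem ξ η⟩

lemma sandwich_mem (a b : H →L[ℂ] H) {c : H →L[ℂ] H} (hc : c ∈ finRank H) :
    a ∘L c ∘L b ∈ finRank H := by
  have : FiniteDimensional ℂ (LinearMap.range c.toLinearMap) := hc
  change FiniteDimensional ℂ _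
  refine Submodule.finiteDimensional_of_le
    (S₂ := (LinearMap.range c.toLinearMap).map a.toLinearMap) ?_
  rintro _ ⟨x, rfl⟩
  exact ⟨c (b x), ⟨b x, rfl⟩, rfl⟩

lemma mem_span_rankOne [CompleteSpace H] {a : H →L[ℂ] H} (ha : a ∈ finRank H) :
    ∃ (n : ℕ) (ξ η : Fin n → H), a = ∑ i, InnerProductSpace.rankOne ℂ (ξ i) (η i) := by
  have : FiniteDimensional ℂ (LinearMap.range a.toLinearMap) := ha
  let b := stdOrthonormalBasis ℂ (LinearMap.range a.toLinearMap)
  refine ⟨_, fun i => (b i : H), fun i => ContinuousLinearMap.adjoint a (b i : H), ?_⟩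
  ext z
  have h := b.sum_repr' ⟨a z, z, rfl⟩
  have h2 := congrArg (Subtype.val) h
  simp only [Submodule.coe_sum, Submodule.coe_smul, Submodule.coe_inner] at h2
  simp [ContinuousLinearMap.adjoint_inner_left, h2]

lemma finRank_induction [CompleteSpace H] {p : finRank H → Prop} (h0 : p 0)
    (hadd : ∀ a b, p a → p b → p (a + b)) (h1 : ∀ ξ η, p (circ ξ η)) (a : finRank H) : p a := by
  obtain ⟨a, ha⟩ := a
  obtain ⟨n, ξ, η, rfl⟩ := mem_span_rankOne ha
  have : (⟨∑ i, InnerProductSpace.rankOne ℂ (ξ i) (η i), ha⟩ : finRank H)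
      = ∑ i, circ (ξ i) (η i) := by
    ext1; simp [circ]
  rw [this]
  exact Finset.sum_induction _ p hadd h0 fun i _ => h1 _ _

lemma opDia_mem [CompleteSpace H] {a b : H →L[ℂ] H} (ha : a ∈ finRank H) (hb : b ∈ finRank H) :
    opDia ι a b ∈ finRank H := by
  have h : ∀ a' b' : finRank H, opDia ι (a' : H →L[ℂ] H) (b' : H →L[ℂ] H) ∈ finRank H := by
    intro a' b'
    induction a' using finRank_induction with
    | h0 =>
      have := opDia_smul_left ι 0 0 (b' : H →L[ℂ] H)
      simp only [zero_smul] at this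
      simp [this]
    | hadd a a' h h' =>
      rw [Submodule.coe_add, opDia_add_left]; exact Submodule.add_mem _ h h'
    | h1 ξ η =>
      induction b' using finRank_induction with
      | h0 =>
        have := opDia_smul_right ι 0 (circ ξ η : H →L[ℂ] H) 0
        simp only [zero_smul] at this
        simp [this]
      | hadd a a' h h' =>
        rw [Submodule.coe_add, opDia_add_right]; exact Submodule.add_mem _ h h'
      | h1 ξ' η' =>
        simp only [circ, opDia_rankOne]
        exact rankOne_mem _ _
  exact h ⟨a, ha⟩ ⟨b, hb⟩

/-- The operation `◇` as a bilinear map `𝒦 × 𝒦 → 𝒦`. -/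
def finRankDia [CompleteSpace H] : finRank H →ₗ[ℂ] finRank H →ₗ[ℂ] finRank H :=
  LinearMap.mk₂ ℂ (fun a b => ⟨opDia ι a b, opDia_mem ι a.2 b.2⟩)
    (fun _ _ _ => Subtype.ext (opDia_add_left ι _ _ _))
    (fun _ _ _ => Subtype.ext (opDia_smul_left ι _ _ _))
    (fun _ _ _ => Subtype.ext (opDia_add_right ι _ _ _))
    (fun _ _ _ => Subtype.ext (opDia_smul_right ι _ _ _))

end Hilbert

section PQ

/-- The amplification `𝒦E = 𝒦 ⊗ E` of a linear space `E`. -/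
def Amp (L : Type*) [NormedAddCommGroup L] [InnerProductSpace ℂ L]
    (E : Type*) [AddCommGroup E] [Module ℂ E] : Type _ :=
  finRank L ⊗[ℂ] E

variable {L : Type*} [NormedAddCommGroup L] [InnerProductSpace ℂ L]

/-- The map `c ↦ a c b` on `𝒦`. -/
def finRankSandwich (a b : L →L[ℂ] L) : finRank L →ₗ[ℂ] finRank L where
  toFun c := ⟨a ∘L c ∘L b, sandwich_mem a b c.2⟩
  map_add' c d := by ext1; simp
  map_smul' r c := by ext1; simp

section Algebra

variable {E : Type*} [AddCommGroup E] [Module ℂ E] {F : Type*} [AddCommGroup F] [Module ℂ F]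
  {G : Type*} [AddCommGroup G] [Module ℂ G]

instance instAddCommGroupAmp : AddCommGroup (Amp L E) :=
  inferInstanceAs (AddCommGroup (finRank L ⊗[ℂ] E))

instance instModuleAmp : Module ℂ (Amp L E) :=
  inferInstanceAs (Module ℂ (finRank L ⊗[ℂ] E))

/-- The elementary tensor `a ⊗ x ∈ 𝒦E`, as a bilinear map. -/
def Amp.tmul : finRank L →ₗ[ℂ] E →ₗ[ℂ] Amp L E :=
  TensorProduct.mk ℂ (finRank L) E

@[elab_as_elim, induction_eliminator]
lemma Amp.induction_on {p : Amp L E → Prop} (u : Amp L E) (zero : p 0)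
    (tmul : ∀ (a : finRank L) (x : E), p (Amp.tmul a x))
    (add : ∀ u v, p u → p v → p (u + v)) : p u :=
  TensorProduct.induction_on (motive := p) u zero tmul add

/-- The linear map on `𝒦E` associated with a bilinear map on `𝒦 × E`. -/
def Amp.lift (B : finRank L →ₗ[ℂ] E →ₗ[ℂ] G) : Amp L E →ₗ[ℂ] G :=
  TensorProduct.lift B

@[simp] lemma Amp.lift_tmul (B : finRank L →ₗ[ℂ] E →ₗ[ℂ] G) (a : finRank L) (x : E) :
    Amp.lift B (Amp.tmul a x) = B a x :=
  TensorProduct.lift.tmul a x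

/-- The bimodule operation `u ↦ a · u · b` on `𝒦E`, with `a · (c ⊗ x) · b = (a c b) ⊗ x`. -/
def sandwich (a b : L →L[ℂ] L) : Amp L E →ₗ[ℂ] Amp L E :=
  Amp.lift (Amp.tmul ∘ₗ finRankSandwich a b)

@[simp] lemma sandwich_tmul (a b : L →L[ℂ] L) (c : finRank L) (x : E) :
    sandwich a b (Amp.tmul c x) = Amp.tmul (finRankSandwich a b c) x := by
  simp [sandwich]

/-- The amplification `φ_∞ : 𝒦E → 𝒦F`, `a ⊗ x ↦ a ⊗ φ x`, of a linear operator `φ : E → F`. -/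
def ampMap (L : Type*) [NormedAddCommGroup L] [InnerProductSpace ℂ L]
    {E : Type*} [AddCommGroup E] [Module ℂ E] {F : Type*} [AddCommGroup F] [Module ℂ F]
    (φ : E →ₗ[ℂ] F) : Amp L E →ₗ[ℂ] Amp L F :=
  Amp.lift (Amp.tmul.compl₂ φ)

@[simp] lemma ampMap_tmul (φ : E →ₗ[ℂ] F) (a : finRank L) (x : E) :
    ampMap L φ (Amp.tmul a x) = Amp.tmul a (φ x) := by
  simp [ampMap]

/-- The amplification `B_∞ : 𝒦E × 𝒦F → 𝒦G` of a bilinear operator `B : E × F → G`: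
`B_∞ (a ⊗ x, b ⊗ y) = (a ◇ b) ⊗ B (x, y)`. -/
def ampBilin [CompleteSpace L] (ι : HilbertSquare L ≃ₗᵢ[ℂ] L) (B : E →ₗ[ℂ] F →ₗ[ℂ] G) :
    Amp L E →ₗ[ℂ] Amp L F →ₗ[ℂ] Amp L G :=
  Amp.lift (LinearMap.mk₂ ℂ
    (fun (a : finRank L) (x : E) => Amp.lift ((Amp.tmul ∘ₗ finRankDia ι a).compl₂ (B x)))
    (fun a a' x => LinearMap.ext fun v => by
      induction v with
      | zero => simp
      | tmul b y => simp
      | add v w hv hw => rw [map_add _ v w, map_add _ v w, hv, hw])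
    (fun c a x => LinearMap.ext fun v => by
      induction v with
      | zero => simp
      | tmul b y => simp
      | add v w hv hw => rw [map_add _ v w, map_add _ v w, hv, hw])
    (fun a x x' => LinearMap.ext fun v => by
      induction v with
      | zero => simp
      | tmul b y => simp
      | add v w hv hw => rw [map_add _ v w, map_add _ v w, hv, hw])
    (fun c a x => LinearMap.ext fun v => by
      induction v with
      | zero => simp
      | tmul b y => simp
      | add v w hv hw => rw [map_add _ v w, map_add _ v w, hv, hw]))

@[simp] lemma ampBilin_tmul [CompleteSpace L] (ι : HilbertSquare L ≃ₗᵢ[ℂ] L)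
    (B : E →ₗ[ℂ] F →ₗ[ℂ] G) (a b : finRank L) (x : E) (y : F) :
    ampBilin ι B (Amp.tmul a x) (Amp.tmul b y) = Amp.tmul (finRankDia ι a b) (B x y) := by
  simp [ampBilin]

/-- The operation `(u, v) ↦ u ◇ v` from `𝒦E × 𝒦F` to `𝒦(E ⊗ F)`: the amplification of the
canonical bilinear operator `(x, y) ↦ x ⊗ y`. -/
def ampDia [CompleteSpace L] (ι : HilbertSquare L ≃ₗᵢ[ℂ] L) :
    Amp L E →ₗ[ℂ] Amp L F →ₗ[ℂ] Amp L (E ⊗[ℂ] F) :=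
  ampBilin ι (TensorProduct.mk ℂ E F)

@[simp] lemma ampDia_tmul [CompleteSpace L] (ι : HilbertSquare L ≃ₗᵢ[ℂ] L)
    (a b : finRank L) (x : E) (y : F) :
    ampDia ι (Amp.tmul a x) (Amp.tmul b y) = Amp.tmul (finRankDia ι a b) (x ⊗ₜ[ℂ] y) := by
  simp [ampDia]

/-- A proto-quantum semi-norm: a semi-norm on `𝒦E` making it a contractive bimodule over the
bounded operators. -/
def IsPQSeminorm (q : Seminorm ℂ (Amp L E)) : Prop :=
  ∀ (a b : L →L[ℂ] L) (u : Amp L E), q (sandwich a b u) ≤ ‖a‖ * q u * ‖b‖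

lemma sandwich_circ (ξ η e e' : L) (he : ‖e‖ = 1) (he' : ‖e'‖ = 1) (x : E) :
    sandwich (InnerProductSpace.rankOne ℂ ξ e) (InnerProductSpace.rankOne ℂ e' η)
      (Amp.tmul (circ e e') x) = Amp.tmul (circ ξ η) x := by
  rw [sandwich_tmul]
  congr 2
  ext z
  simp [finRankSandwich, circ, inner_self_eq_norm_sq_to_K, he, he']

lemma IsPQSeminorm.circ_le {q : Seminorm ℂ (Amp L E)} (hq : IsPQSeminorm q)
    (ξ η e e' : L) (he : ‖e‖ = 1) (he' : ‖e'‖ = 1) (x : E) :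
    q (Amp.tmul (circ ξ η) x) ≤ ‖ξ‖ * ‖η‖ * q (Amp.tmul (circ e e') x) := by
  have h := hq (InnerProductSpace.rankOne ℂ ξ e) (InnerProductSpace.rankOne ℂ e' η)
    (Amp.tmul (circ e e') x)
  rw [sandwich_circ ξ η e e' he he'] at h
  simp only [InnerProductSpace.norm_rankOne, he, he', mul_one, one_mul] at h
  linarith

/-- The slice map `a ⊗ x ↦ ⟪ξ, a η⟫ x`. -/
def slice (ξ η : L) : Amp L E →ₗ[ℂ] E :=
  Amp.lift
    ((LinearMap.lsmul ℂ E).comp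
      ((innerSL ℂ ξ).toLinearMap ∘ₗ (ContinuousLinearMap.apply ℂ L η).toLinearMap ∘ₗ
        (finRank L).subtype))

@[simp] lemma slice_tmul (ξ η : L) (a : finRank L) (x : E) :
    slice ξ η (Amp.tmul a x) = ⟪ξ, (a : L →L[ℂ] L) η⟫_ℂ • x := by
  simp [slice]

lemma sandwich_eq_slice (e e' ξ η : L) (u : Amp L E) :
    sandwich (InnerProductSpace.rankOne ℂ e ξ) (InnerProductSpace.rankOne ℂ η e') u
      = Amp.tmul (circ e e') (slice ξ η u) := by
  induction u with
  | zero => simp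
  | tmul a x =>
    rw [sandwich_tmul, slice_tmul, map_smul, ← LinearMap.smul_apply, ← map_smul]
    congr 2
    ext z
    simp [finRankSandwich, circ, smul_smul, mul_comm]
  | add u v hu hv => simp only [map_add, hu, hv]

lemma eq_zero_of_slice {u : Amp L E} (h : ∀ ξ η, slice ξ η u = 0) : u = 0 := by
  classical
  let B := Module.Basis.ofVectorSpace ℂ E
  let eqv : Amp L E ≃ₗ[ℂ] (_ →₀ finRank L) := TensorProduct.equivFinsuppOfBasisRight (M := finRank L) B
  have key : ∀ (u : Amp L E) (ξ η : L) (i), B.repr (slice ξ η u) i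
      = ⟪ξ, (eqv u i : L →L[ℂ] L) η⟫_ℂ := by
    intro u ξ η i
    induction u with
    | zero => simp
    | tmul a x =>
      have h := TensorProduct.equivFinsuppOfBasisRight_apply_tmul_apply B a x i
      have h' : eqv (Amp.tmul a x) i = B.repr x i • a := h
      rw [h']
      simp [mul_comm]
    | add u v hu hv => simp [hu, hv]
  apply eqv.injective
  rw [map_zero]
  ext i z
  have h1 := key u ((eqv u i : L →L[ℂ] L) z) z i
  rw [h, map_zero, Finsupp.zero_apply] at h1
  simpa using inner_self_eq_zero.mp h1.symm

end Algebra

/-- A (normed) proto-quantum space `E`: a normed space together with a proto-quantum semi-norm on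
`𝒦E` whose underlying norm `‖x‖ = ‖Q ⊗ x‖`, for `Q = ξ ∘ η` an arbitrary operator of rank one and
norm one, is the norm of `E`. The semi-norm on `𝒦E` is then automatically a norm. -/
class PQSpace (L : Type*) [NormedAddCommGroup L] [InnerProductSpace ℂ L]
    (E : Type*) [NormedAddCommGroup E] [NormedSpace ℂ E] where
  /-- The norm on the amplification. -/
  pqNorm : Seminorm ℂ (Amp L E)
  isPQSeminorm : IsPQSeminorm pqNorm
  pqNorm_circ : ∀ ξ η : L, ‖ξ‖ = 1 → ‖η‖ = 1 → ∀ x : E, pqNorm (Amp.tmul (circ ξ η) x) = ‖x‖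

section Norm

variable {E : Type*} [NormedAddCommGroup E] [NormedSpace ℂ E] [PQSpace L E]

lemma norm_slice_le (ξ η : L) (u : Amp L E) :
    ‖slice ξ η u‖ ≤ ‖ξ‖ * ‖η‖ * PQSpace.pqNorm u := by
  by_cases hξ : ξ = 0
  · subst hξ
    have : slice (0 : L) η u = 0 := by
      induction u with
      | zero => simp
      | tmul a x => simp
      | add u v hu hv => simp [hu, hv]
    simp [this]
  · have he : ‖((‖ξ‖⁻¹ : ℝ) : ℂ) • ξ‖ = 1 := by
      rw [norm_smul]; simp [hξ]
    rw [← PQSpace.pqNorm_circ (L := L) _ _ he he, ← sandwich_eq_slice]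
    refine (PQSpace.isPQSeminorm _ _ _).trans (le_of_eq ?_)
    rw [InnerProductSpace.norm_rankOne, InnerProductSpace.norm_rankOne, he]
    ring

lemma pqNorm_eq_zero (u : Amp L E) : PQSpace.pqNorm u = 0 ↔ u = 0 := by
  refine ⟨fun h => eq_zero_of_slice fun ξ η => ?_, fun h => by simp [h]⟩
  have := norm_slice_le ξ η u
  rw [h, mul_zero] at this
  exact norm_le_zero_iff.mp this

instance instNormAmp : Norm (Amp L E) := ⟨fun u => PQSpace.pqNorm u⟩

lemma norm_amp_def (u : Amp L E) : ‖u‖ = PQSpace.pqNorm u := rfl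

lemma ampCore : NormedSpace.Core ℂ (Amp L E) where
  norm_nonneg u := apply_nonneg _ u
  norm_smul c u := map_smul_eq_mul (PQSpace.pqNorm (L := L) (E := E)) c u
  norm_triangle u v := map_add_le_add _ u v
  norm_eq_zero_iff u := pqNorm_eq_zero u

/-- The amplification of a proto-quantum space, normed by its proto-quantum norm. -/
instance instNormedAddCommGroupAmp : NormedAddCommGroup (Amp L E) :=
  NormedAddCommGroup.ofCore ampCore

instance instNormedSpaceAmp : NormedSpace ℂ (Amp L E) :=
  NormedSpace.ofCore ampCore

lemma norm_sandwich_le (a b : L →L[ℂ] L) (u : Amp L E) :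
    ‖sandwich a b u‖ ≤ ‖a‖ * ‖u‖ * ‖b‖ :=
  PQSpace.isPQSeminorm a b u

lemma norm_circ_tmul (ξ η : L) (hξ : ‖ξ‖ = 1) (hη : ‖η‖ = 1) (x : E) :
    ‖Amp.tmul (circ ξ η) x‖ = ‖x‖ :=
  PQSpace.pqNorm_circ ξ η hξ hη x

lemma exists_norm_tmul_le [CompleteSpace L] (a : finRank L) :
    ∃ C : ℝ, ∀ x : E, ‖Amp.tmul a x‖ ≤ C * ‖x‖ := by
  induction a using finRank_induction with
  | h0 => exact ⟨0, by simp⟩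
  | hadd a b ha hb =>
    obtain ⟨C, hC⟩ := ha
    obtain ⟨D, hD⟩ := hb
    refine ⟨C + D, fun x => ?_⟩
    rw [map_add, LinearMap.add_apply, add_mul]
    exact (norm_add_le _ _).trans (add_le_add (hC x) (hD x))
  | h1 ξ η =>
    refine ⟨‖ξ‖ * ‖η‖, fun x => ?_⟩
    by_cases hξ : ξ = 0
    · have : circ (0 : L) η = 0 := by ext1; simp [circ]
      simp [hξ, this]
    · have he : ‖((‖ξ‖⁻¹ : ℝ) : ℂ) • ξ‖ = 1 := by
        rw [norm_smul]; simp [hξ]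
      refine (PQSpace.isPQSeminorm.circ_le ξ η _ _ he he x).trans (le_of_eq ?_)
      rw [PQSpace.pqNorm_circ _ _ he he]

/-- The bounded operator `x ↦ a ⊗ x` from `E` to `𝒦E`. -/
def tmulCLM [CompleteSpace L] (a : finRank L) : E →L[ℂ] Amp L E :=
  (Amp.tmul a : E →ₗ[ℂ] Amp L E).mkContinuousOfExistsBound (exists_norm_tmul_le a)

@[simp] lemma tmulCLM_apply [CompleteSpace L] (a : finRank L) (x : E) :
    tmulCLM a x = Amp.tmul a x := rfl

/-- The bounded operator `u ↦ a · u · b` on `𝒦E`. -/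
def sandwichCLM (a b : L →L[ℂ] L) : Amp L E →L[ℂ] Amp L E :=
  (sandwich a b).mkContinuous (‖a‖ * ‖b‖) fun u => (norm_sandwich_le a b u).trans (le_of_eq (by ring))

lemma norm_sandwichCLM_le (a b : L →L[ℂ] L) :
    ‖(sandwichCLM a b : Amp L E →L[ℂ] Amp L E)‖ ≤ ‖a‖ * ‖b‖ :=
  LinearMap.mkContinuous_norm_le _ (by positivity) _

@[simp] lemma sandwichCLM_apply (a b : L →L[ℂ] L) (u : Amp L E) :
    sandwichCLM a b u = sandwich a b u := rfl

end Norm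

/-- A linear operator between proto-quantum spaces is completely isometric if its amplification
is isometric. -/
def IsCompleteIsometry (L : Type*) [NormedAddCommGroup L] [InnerProductSpace ℂ L]
    {E : Type*} [NormedAddCommGroup E] [NormedSpace ℂ E] [PQSpace L E]
    {F : Type*} [NormedAddCommGroup F] [NormedSpace ℂ F] [PQSpace L F] (φ : E →ₗ[ℂ] F) : Prop :=
  ∀ u : Amp L E, ‖ampMap L φ u‖ = ‖u‖

section LpSpace

variable [CompleteSpace L] {E : Type*} [NormedAddCommGroup E] [NormedSpace ℂ E] [PQSpace L E]
  {X : Type*} [MeasurableSpace X] (μ : Measure X) (p : ℝ≥0∞) [Fact (1 ≤ p)]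

/-- The operator `α : 𝒦(L_p(X, E)) → L_p(X, 𝒦E)` taking `a ⊗ x` to `t ↦ a ⊗ x(t)`. -/
def lpAlpha : Amp L (Lp E p μ) →ₗ[ℂ] Lp (Amp L E) p μ :=
  Amp.lift (LinearMap.mk₂ ℂ
    (fun (a : finRank L) (f : Lp E p μ) => (tmulCLM a : E →L[ℂ] Amp L E).compLpL p μ f)
    (fun a b f => by
      have : (tmulCLM (a + b) : E →L[ℂ] Amp L E) = tmulCLM a + tmulCLM b := by
        ext x; simp
      rw [this, ContinuousLinearMap.add_compLpL]; rfl)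
    (fun c a f => by
      have : (tmulCLM (c • a) : E →L[ℂ] Amp L E) = c • tmulCLM a := by
        ext x; simp
      rw [this, ContinuousLinearMap.smul_compLpL]; rfl)
    (fun a f g => map_add _ f g)
    (fun c a f => map_smul _ c f))

lemma lpAlpha_tmul (a : finRank L) (f : Lp E p μ) :
    lpAlpha μ p (Amp.tmul a f) = (tmulCLM a : E →L[ℂ] Amp L E).compLpL p μ f := rfl

lemma lpAlpha_tmul_coeFn (a : finRank L) (f : Lp E p μ) :
    lpAlpha μ p (Amp.tmul a f) =ᵐ[μ] fun t => Amp.tmul a (f t) :=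
  ContinuousLinearMap.coeFn_compLpL (tmulCLM a : E →L[ℂ] Amp L E) f

lemma lpAlpha_sandwich (a b : L →L[ℂ] L) (u : Amp L (Lp E p μ)) :
    lpAlpha μ p (sandwich a b u)
      = (sandwichCLM a b : Amp L E →L[ℂ] Amp L E).compLpL p μ (lpAlpha μ p u) := by
  induction u with
  | zero => simp
  | tmul c f =>
    rw [sandwich_tmul]
    apply Lp.ext
    filter_upwards [lpAlpha_tmul_coeFn μ p c f, lpAlpha_tmul_coeFn μ p (finRankSandwich a b c) f,
      ContinuousLinearMap.coeFn_compLpL (sandwichCLM a b : Amp L E →L[ℂ] Amp L E)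
        (lpAlpha μ p (Amp.tmul c f))] with t h1 h2 h3
    rw [h2, h3, h1]
    simp
  | add u v hu hv => simp only [map_add, hu, hv]

/-- The standard proto-quantum norm on `L_p(X, E)`: the norm of `u ∈ 𝒦(L_p(X, E))` is the norm of
`α u` in `L_p(X, 𝒦E)`. -/
instance instPQSpaceLp : PQSpace L (Lp E p μ) where
  pqNorm := (normSeminorm ℂ (Lp (Amp L E) p μ)).comp (lpAlpha μ p)
  isPQSeminorm a b u := by
    simp only [Seminorm.comp_apply, coe_normSeminorm, lpAlpha_sandwich]
    refine (ContinuousLinearMap.le_opNorm _ _).trans ?_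
    have h := (ContinuousLinearMap.norm_compLpL_le (p := p) (μ := μ)
      (sandwichCLM a b : Amp L E →L[ℂ] Amp L E)).trans (norm_sandwichCLM_le a b)
    calc _ ≤ (‖a‖ * ‖b‖) * ‖lpAlpha μ p u‖ := by gcongr
      _ = _ := by ring
  pqNorm_circ ξ η hξ hη f := by
    simp only [Seminorm.comp_apply, coe_normSeminorm]
    rw [Lp.norm_def, Lp.norm_def]
    congr 1
    refine eLpNorm_congr_norm_ae ?_
    filter_upwards [lpAlpha_tmul_coeFn μ p (circ ξ η) f] with t ht
    rw [ht, norm_circ_tmul ξ η hξ hη]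

end LpSpace

section Pop

variable [CompleteSpace L] (ι : HilbertSquare L ≃ₗᵢ[ℂ] L)
  {E : Type*} [NormedAddCommGroup E] [NormedSpace ℂ E] [PQSpace L E]
  {F : Type*} [NormedAddCommGroup F] [NormedSpace ℂ F] [PQSpace L F]

/-- The set of all numbers `∑ₖ ‖aₖ‖ ‖uₖ‖ ‖vₖ‖ ‖bₖ‖` taken over all representations
`U = ∑ₖ aₖ · (uₖ ◇ vₖ) · bₖ`. -/
def popSums (U : Amp L (E ⊗[ℂ] F)) : Set ℝ :=
  {r | ∃ (n : ℕ) (a b : Fin n → L →L[ℂ] L) (u : Fin n → Amp L E) (v : Fin n → Amp L F),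
    U = ∑ k, sandwich (a k) (b k) (ampDia ι (u k) (v k)) ∧
    r = ∑ k, ‖a k‖ * ‖u k‖ * ‖v k‖ * ‖b k‖}

lemma popSums_nonneg {U : Amp L (E ⊗[ℂ] F)} {r : ℝ} (hr : r ∈ popSums ι U) : 0 ≤ r := by
  obtain ⟨n, a, b, u, v, -, rfl⟩ := hr
  exact Finset.sum_nonneg fun k _ => by positivity

lemma popSums_bddBelow (U : Amp L (E ⊗[ℂ] F)) : BddBelow (popSums ι U) :=
  ⟨0, fun _ hr => popSums_nonneg ι hr⟩

lemma zero_mem_popSums : (0 : ℝ) ∈ popSums ι (0 : Amp L (E ⊗[ℂ] F)) :=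
  ⟨0, Fin.elim0, Fin.elim0, Fin.elim0, Fin.elim0, by simp, by simp⟩

lemma add_mem_popSums {U V : Amp L (E ⊗[ℂ] F)} {r s : ℝ} (hr : r ∈ popSums ι U)
    (hs : s ∈ popSums ι V) : r + s ∈ popSums ι (U + V) := by
  obtain ⟨n, a, b, u, v, rfl, rfl⟩ := hr
  obtain ⟨m, a', b', u', v', rfl, rfl⟩ := hs
  refine ⟨n + m, Fin.append a a', Fin.append b b', Fin.append u u', Fin.append v v', ?_, ?_⟩
  · rw [Fin.sum_univ_add]
    simp only [Fin.append_left, Fin.append_right]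
  · rw [Fin.sum_univ_add]
    simp only [Fin.append_left, Fin.append_right]

lemma sandwich_sandwich {G : Type*} [AddCommGroup G] [Module ℂ G] (a b c d : L →L[ℂ] L)
    (U : Amp L G) : sandwich a b (sandwich c d U) = sandwich (a ∘L c) (d ∘L b) U := by
  induction U with
  | zero => simp
  | tmul e x => simp only [sandwich_tmul]; congr 2
  | add U V hU hV => rw [map_add, map_add, map_add, hU, hV]

lemma sandwich_mem_popSums {U : Amp L (E ⊗[ℂ] F)} {r : ℝ} (hr : r ∈ popSums ι U)
    (a b : L →L[ℂ] L) : ∃ s ∈ popSums ι (sandwich a b U), s ≤ ‖a‖ * r * ‖b‖ := by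
  obtain ⟨n, c, d, u, v, rfl, rfl⟩ := hr
  refine ⟨_, ⟨n, fun k => a ∘L c k, fun k => d k ∘L b, u, v, ?_, rfl⟩, ?_⟩
  · rw [map_sum]
    exact Finset.sum_congr rfl fun k _ => sandwich_sandwich _ _ _ _ _
  · rw [Finset.mul_sum, Finset.sum_mul]
    refine Finset.sum_le_sum fun k _ => ?_
    calc ‖a ∘L c k‖ * ‖u k‖ * ‖v k‖ * ‖d k ∘L b‖
        ≤ (‖a‖ * ‖c k‖) * ‖u k‖ * ‖v k‖ * (‖d k‖ * ‖b‖) := by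
          gcongr
          · exact ContinuousLinearMap.opNorm_comp_le _ _
          · exact ContinuousLinearMap.opNorm_comp_le _ _
      _ = _ := by ring

lemma smul_mem_popSums {U : Amp L (E ⊗[ℂ] F)} {r : ℝ} (hr : r ∈ popSums ι U) (c : ℂ) :
    ‖c‖ * r ∈ popSums ι (c • U) := by
  obtain ⟨n, a, b, u, v, rfl, rfl⟩ := hr
  refine ⟨n, a, b, fun k => c • u k, v, ?_, ?_⟩
  · rw [Finset.smul_sum]
    exact Finset.sum_congr rfl fun k _ => by rw [map_smul, LinearMap.smul_apply, map_smul]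
  · rw [Finset.mul_sum]
    exact Finset.sum_congr rfl fun k _ => by rw [norm_smul]; ring

lemma popSums_nonempty [Nontrivial L] (U : Amp L (E ⊗[ℂ] F)) : (popSums ι U).Nonempty := by
  obtain ⟨e, he⟩ := exists_norm_eq L zero_le_one
  induction U with
  | zero => exact ⟨0, zero_mem_popSums ι⟩
  | add U V hU hV =>
    obtain ⟨r, hr⟩ := hU
    obtain ⟨s, hs⟩ := hV
    exact ⟨r + s, add_mem_popSums ι hr hs⟩
  | tmul a w =>
    induction w with
    | zero => rw [map_zero]; exact ⟨0, zero_mem_popSums ι⟩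
    | add x y hx hy =>
      obtain ⟨r, hr⟩ := hx
      obtain ⟨s, hs⟩ := hy
      rw [map_add]
      exact ⟨r + s, add_mem_popSums ι hr hs⟩
    | tmul x y =>
      induction a using finRank_induction with
      | h0 => rw [map_zero]; exact ⟨0, zero_mem_popSums ι⟩
      | hadd a b ha hb =>
        obtain ⟨r, hr⟩ := ha
        obtain ⟨s, hs⟩ := hb
        rw [map_add]
        exact ⟨r + s, add_mem_popSums ι hr hs⟩
      | h1 ξ η =>
        have hee : ‖vecDia ι e e‖ = 1 := by rw [norm_vecDia, he, one_mul]
        refine ⟨_, ⟨1, fun _ => InnerProductSpace.rankOne ℂ ξ (vecDia ι e e),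
          fun _ => InnerProductSpace.rankOne ℂ (vecDia ι e e) η,
          fun _ => Amp.tmul (circ e e) x, fun _ => Amp.tmul (circ e e) y, ?_, rfl⟩⟩
        have h : finRankDia ι (circ e e) (circ e e) = circ (vecDia ι e e) (vecDia ι e e) :=
          Subtype.ext (opDia_rankOne ι e e e e)
        rw [Fin.sum_univ_one, ampDia_tmul, h, sandwich_circ _ _ _ _ hee hee]

/-- The semi-norm `‖U‖_pop`: the infimum of `∑ₖ ‖aₖ‖ ‖uₖ‖ ‖vₖ‖ ‖bₖ‖` over all representations
`U = ∑ₖ aₖ · (uₖ ◇ vₖ) · bₖ`. -/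
def popSeminorm [Nontrivial L] : Seminorm ℂ (Amp L (E ⊗[ℂ] F)) :=
  Seminorm.ofSMulLE (fun U => sInf (popSums ι U))
    (le_antisymm (csInf_le (popSums_bddBelow ι _) (zero_mem_popSums ι))
      (Real.sInf_nonneg fun _ hr => popSums_nonneg ι hr))
    (fun U V => by
      rw [← csInf_add (popSums_nonempty ι U) (popSums_bddBelow ι U) (popSums_nonempty ι V)
        (popSums_bddBelow ι V)]
      refine csInf_le_csInf (popSums_bddBelow ι _)
        ((popSums_nonempty ι U).add (popSums_nonempty ι V)) ?_
      rintro _ ⟨r, hr, s, hs, rfl⟩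
      exact add_mem_popSums ι hr hs)
    (fun c U => by
      rw [← smul_eq_mul, ← Real.sInf_smul_of_nonneg (norm_nonneg c)]
      refine csInf_le_csInf (popSums_bddBelow ι _) ((popSums_nonempty ι U).smul_set) ?_
      rintro _ ⟨r, hr, rfl⟩
      exact smul_mem_popSums ι hr c)

lemma popSeminorm_apply [Nontrivial L] (U : Amp L (E ⊗[ℂ] F)) :
    popSeminorm ι U = sInf (popSums ι U) := rfl

lemma isPQSeminorm_popSeminorm [Nontrivial L] :
    IsPQSeminorm (popSeminorm ι : Seminorm ℂ (Amp L (E ⊗[ℂ] F))) := by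
  intro a b U
  rw [popSeminorm_apply, popSeminorm_apply]
  have h : ∀ r ∈ popSums ι U, sInf (popSums ι (sandwich a b U)) ≤ (‖a‖ * ‖b‖) * r := by
    intro r hr
    obtain ⟨s, hs, hsr⟩ := sandwich_mem_popSums ι hr a b
    exact (csInf_le (popSums_bddBelow ι _) hs).trans (hsr.trans (le_of_eq (by ring)))
  have h2 : sInf (popSums ι (sandwich a b U)) ≤ (‖a‖ * ‖b‖) • sInf (popSums ι U) := by
    rw [← Real.sInf_smul_of_nonneg (by positivity)]
    refine le_csInf ((popSums_nonempty ι U).smul_set) ?_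
    rintro _ ⟨r, hr, rfl⟩
    exact h r hr
  rw [smul_eq_mul] at h2
  linarith

/-- The amplification of a linear functional, with `𝒦 ⊗ ℂ` identified with `𝒦`. -/
def ampFunctional {G : Type*} [AddCommGroup G] [Module ℂ G] (f : G →ₗ[ℂ] ℂ) :
    Amp L G →ₗ[ℂ] finRank L :=
  Amp.lift ((LinearMap.lsmul ℂ (finRank L)).flip.compl₂ f)

@[simp] lemma ampFunctional_tmul {G : Type*} [AddCommGroup G] [Module ℂ G] (f : G →ₗ[ℂ] ℂ)
    (a : finRank L) (x : G) : ampFunctional f (Amp.tmul a x) = f x • a := by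
  simp [ampFunctional]

lemma inner_ampFunctional {G : Type*} [AddCommGroup G] [Module ℂ G] (f : G →ₗ[ℂ] ℂ)
    (u : Amp L G) (ξ η : L) :
    ⟪ξ, (ampFunctional f u : L →L[ℂ] L) η⟫_ℂ = f (slice ξ η u) := by
  induction u with
  | zero => simp
  | tmul a x => simp [mul_comm]
  | add u v hu hv => simp [hu, hv]

lemma norm_ampFunctional_le (f : E →L[ℂ] ℂ) (u : Amp L E) :
    ‖ampFunctional f.toLinearMap u‖ ≤ ‖f‖ * ‖u‖ := by
  refine ContinuousLinearMap.opNorm_le_bound _ (by positivity) fun η => ?_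
  change ‖(ampFunctional f.toLinearMap u : L →L[ℂ] L) η‖ ≤ _
  set z := (ampFunctional f.toLinearMap u : L →L[ℂ] L) η with hz
  by_cases h0 : ‖z‖ = 0
  · rw [h0]; positivity
  have h1 : ‖z‖ * ‖z‖ ≤ (‖f‖ * ‖u‖ * ‖η‖) * ‖z‖ := by
    have h2 : ⟪z, z⟫_ℂ = f (slice z η u) := by
      rw [hz]; exact inner_ampFunctional f.toLinearMap u _ η
    have h3 : ‖⟪z, z⟫_ℂ‖ = ‖z‖ * ‖z‖ := by
      rw [inner_self_eq_norm_sq_to_K]; simp [sq]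
    rw [← h3, h2]
    calc ‖f (slice z η u)‖ ≤ ‖f‖ * ‖slice z η u‖ := f.le_opNorm _
      _ ≤ ‖f‖ * (‖z‖ * ‖η‖ * ‖u‖) := by gcongr; exact norm_slice_le z η u
      _ = _ := by ring
  exact le_of_mul_le_mul_right h1 (lt_of_le_of_ne (norm_nonneg _) (Ne.symm h0))

/-- The functional `f ⊗ g : x ⊗ y ↦ f x * g y`. -/
def tensorFunctional {E F : Type*} [AddCommGroup E] [Module ℂ E] [AddCommGroup F] [Module ℂ F]
    (f : E →ₗ[ℂ] ℂ) (g : F →ₗ[ℂ] ℂ) : E ⊗[ℂ] F →ₗ[ℂ] ℂ :=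
  TensorProduct.lift ((LinearMap.mul ℂ ℂ).compl₁₂ f g)

lemma ampFunctional_sandwich {G : Type*} [AddCommGroup G] [Module ℂ G] (f : G →ₗ[ℂ] ℂ)
    (a b : L →L[ℂ] L) (u : Amp L G) :
    ampFunctional f (sandwich a b u) = finRankSandwich a b (ampFunctional f u) := by
  induction u with
  | zero => simp
  | tmul c x => simp
  | add u v hu hv => simp only [map_add, hu, hv]

lemma ampFunctional_dia (f : E →ₗ[ℂ] ℂ) (g : F →ₗ[ℂ] ℂ) (u : Amp L E) (v : Amp L F) :
    ampFunctional (tensorFunctional f g) (ampDia ι u v)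
      = finRankDia ι (ampFunctional f u) (ampFunctional g v) := by
  induction u with
  | zero => simp
  | add u u' hu hv => simp only [map_add, LinearMap.add_apply, hu, hv]
  | tmul a x =>
    induction v with
    | zero => simp
    | add v v' hu hv => simp only [map_add, hu, hv]
    | tmul b y => simp [tensorFunctional, smul_smul, mul_comm]

lemma norm_ampFunctional_le_pop [Nontrivial L] (f : E →L[ℂ] ℂ) (g : F →L[ℂ] ℂ)
    (U : Amp L (E ⊗[ℂ] F)) :
    ‖ampFunctional (tensorFunctional f.toLinearMap g.toLinearMap) U‖
      ≤ ‖f‖ * ‖g‖ * popSeminorm ι U := by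
  rw [popSeminorm_apply, ← smul_eq_mul, ← Real.sInf_smul_of_nonneg (by positivity)]
  refine le_csInf ((popSums_nonempty ι U).smul_set) ?_
  rintro _ ⟨_, ⟨n, a, b, u, v, rfl, rfl⟩, rfl⟩
  simp only [smul_eq_mul]
  rw [map_sum, Finset.mul_sum]
  refine (norm_sum_le _ _).trans (Finset.sum_le_sum fun k _ => ?_)
  rw [ampFunctional_sandwich, ampFunctional_dia]
  set p := ampFunctional f.toLinearMap (u k) with hp
  set q := ampFunctional g.toLinearMap (v k) with hq
  have h1 : ‖finRankSandwich (a k) (b k) (finRankDia ι p q)‖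
      ≤ ‖a k‖ * (‖opDia ι (p : L →L[ℂ] L) q‖ * ‖b k‖) := by
    change ‖a k ∘L (opDia ι (p : L →L[ℂ] L) q) ∘L b k‖ ≤ _
    refine (ContinuousLinearMap.opNorm_comp_le _ _).trans ?_
    gcongr
    exact ContinuousLinearMap.opNorm_comp_le _ _
  refine h1.trans ?_
  calc ‖a k‖ * (‖opDia ι (p : L →L[ℂ] L) q‖ * ‖b k‖)
      ≤ ‖a k‖ * (((‖f‖ * ‖u k‖) * (‖g‖ * ‖v k‖)) * ‖b k‖) := by
        gcongr
        refine (norm_opDia_le ι _ _).trans ?_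
        gcongr
        · exact norm_ampFunctional_le f (u k)
        · exact norm_ampFunctional_le g (v k)
    _ = _ := by ring

lemma eq_zero_of_tensorFunctional {E F : Type*} [NormedAddCommGroup E] [NormedSpace ℂ E]
    [NormedAddCommGroup F] [NormedSpace ℂ F] {w : E ⊗[ℂ] F}
    (h : ∀ (f : E →L[ℂ] ℂ) (g : F →L[ℂ] ℂ), tensorFunctional f.toLinearMap g.toLinearMap w = 0) :
    w = 0 := by
  classical
  let B := Module.Basis.ofVectorSpace ℂ F
  let S : (E →L[ℂ] ℂ) → E ⊗[ℂ] F →ₗ[ℂ] F := fun f =>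
    TensorProduct.lift ((LinearMap.lsmul ℂ F).comp f.toLinearMap)
  have hS : ∀ f g (w : E ⊗[ℂ] F), tensorFunctional f.toLinearMap g.toLinearMap w
      = (g : F →L[ℂ] ℂ) (S f w) := by
    intro f g w
    induction w with
    | zero => simp
    | tmul x y => simp [tensorFunctional, S]
    | add x y hx hy => rw [map_add, map_add, map_add, hx, hy]
  have h1 : ∀ f, S f w = 0 := fun f =>
    (SeparatingDual.eq_zero_iff_forall_dual_eq_zero (R := ℂ) (S f w)).mpr fun g => by rw [← hS]; exact h f g
  let eqv := TensorProduct.equivFinsuppOfBasisRight (M := E) B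
  have h2 : ∀ (f : E →L[ℂ] ℂ) (i) (w : E ⊗[ℂ] F), B.repr (S f w) i = f (eqv w i) := by
    intro f i w
    induction w with
    | zero => simp
    | tmul x y =>
      simp [eqv, S, mul_comm]
    | add x y hx hy => simp [hx, hy]
  apply eqv.injective
  rw [map_zero]
  ext i
  refine (SeparatingDual.eq_zero_iff_forall_dual_eq_zero (R := ℂ) _).mpr fun f => ?_
  rw [← h2, h1]
  simp

/-- The linear space `E ⊗ F`, regarded as the underlying space of the non-completed projective
tensor product `E ⊗_pop F`. -/
def PopTensor (_ι : HilbertSquare L ≃ₗᵢ[ℂ] L) (E F : Type*)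
    [AddCommGroup E] [Module ℂ E] [AddCommGroup F] [Module ℂ F] : Type _ :=
  E ⊗[ℂ] F

instance instAddCommGroupPopTensor (E F : Type*) [AddCommGroup E] [Module ℂ E] [AddCommGroup F]
    [Module ℂ F] : AddCommGroup (PopTensor ι E F) :=
  inferInstanceAs (AddCommGroup (E ⊗[ℂ] F))

instance instModulePopTensor (E F : Type*) [AddCommGroup E] [Module ℂ E] [AddCommGroup F]
    [Module ℂ F] : Module ℂ (PopTensor ι E F) :=
  inferInstanceAs (Module ℂ (E ⊗[ℂ] F))

/-- The elementary tensor `x ⊗ y ∈ E ⊗_pop F`, as a bilinear map. -/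
def PopTensor.tmul {E F : Type*} [AddCommGroup E] [Module ℂ E] [AddCommGroup F] [Module ℂ F] :
    E →ₗ[ℂ] F →ₗ[ℂ] PopTensor ι E F :=
  TensorProduct.mk ℂ E F

variable [Nontrivial L]

variable (L) in
lemma exists_unit : ∃ e : L, ‖e‖ = 1 := exists_norm_eq L zero_le_one

variable (L) in
/-- A unit vector of `L`. -/
def unitVec : L := (exists_unit L).choose

variable (L) in
lemma norm_unitVec : ‖unitVec L‖ = 1 := (exists_unit L).choose_spec

/-- The underlying semi-norm `‖x‖ = ‖Q ⊗ x‖` of a proto-quantum semi-norm, for a rank one operator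
`Q` of norm one. -/
def underlyingSeminorm {G : Type*} [AddCommGroup G] [Module ℂ G] (q : Seminorm ℂ (Amp L G)) :
    Seminorm ℂ G :=
  q.comp (Amp.tmul (circ (unitVec L) (unitVec L)))

lemma underlyingSeminorm_apply {G : Type*} [AddCommGroup G] [Module ℂ G]
    {q : Seminorm ℂ (Amp L G)} (hq : IsPQSeminorm q) (ξ η : L) (hξ : ‖ξ‖ = 1) (hη : ‖η‖ = 1)
    (x : G) : q (Amp.tmul (circ ξ η) x) = underlyingSeminorm q x := by
  refine le_antisymm ?_ ?_
  · have := hq.circ_le ξ η _ _ (norm_unitVec L) (norm_unitVec L) x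
    rwa [hξ, hη, one_mul, one_mul] at this
  · have := hq.circ_le (unitVec L) (unitVec L) ξ η hξ hη x
    rwa [norm_unitVec, one_mul, one_mul] at this

lemma popSeminorm_definite {w : E ⊗[ℂ] F}
    (h : underlyingSeminorm (popSeminorm ι) w = 0) : w = 0 := by
  refine eq_zero_of_tensorFunctional fun f g => ?_
  have h1 := norm_ampFunctional_le_pop ι f g
    (Amp.tmul (circ (unitVec L) (unitVec L)) w : Amp L (E ⊗[ℂ] F))
  have h0 : popSeminorm ι (Amp.tmul (circ (unitVec L) (unitVec L)) w : Amp L (E ⊗[ℂ] F)) = 0 := h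
  rw [h0, mul_zero, ampFunctional_tmul, norm_smul] at h1
  have h2 : ‖circ (unitVec L) (unitVec L)‖ = 1 := by
    change ‖InnerProductSpace.rankOne ℂ (unitVec L) (unitVec L)‖ = 1
    rw [InnerProductSpace.norm_rankOne, norm_unitVec, one_mul]
  rw [h2, mul_one] at h1
  exact norm_le_zero_iff.mp h1

/-- The underlying norm of `E ⊗_pop F`. -/
instance instNormPopTensor : Norm (PopTensor ι E F) :=
  ⟨fun w => underlyingSeminorm (popSeminorm ι : Seminorm ℂ (Amp L (E ⊗[ℂ] F))) w⟩

lemma popCore : NormedSpace.Core ℂ (PopTensor ι E F) where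
  norm_nonneg w :=
    apply_nonneg (underlyingSeminorm (popSeminorm ι : Seminorm ℂ (Amp L (E ⊗[ℂ] F)))) w
  norm_smul c w :=
    map_smul_eq_mul (underlyingSeminorm (popSeminorm ι : Seminorm ℂ (Amp L (E ⊗[ℂ] F)))) c w
  norm_triangle w w' :=
    map_add_le_add (underlyingSeminorm (popSeminorm ι : Seminorm ℂ (Amp L (E ⊗[ℂ] F)))) w w'
  norm_eq_zero_iff w := by
    constructor
    · intro h
      exact popSeminorm_definite ι (E := E) (F := F) h
    · rintro rfl
      exact map_zero (underlyingSeminorm (popSeminorm ι : Seminorm ℂ (Amp L (E ⊗[ℂ] F))))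

instance instNormedAddCommGroupPopTensor : NormedAddCommGroup (PopTensor ι E F) :=
  NormedAddCommGroup.ofCore (popCore ι)

instance instNormedSpacePopTensor : NormedSpace ℂ (PopTensor ι E F) :=
  NormedSpace.ofCore (popCore ι)

/-- The proto-quantum space `E ⊗_pop F`. -/
instance instPQSpacePopTensor : PQSpace L (PopTensor ι E F) where
  pqNorm := (popSeminorm ι : Seminorm ℂ (Amp L (E ⊗[ℂ] F)))
  isPQSeminorm := isPQSeminorm_popSeminorm ι (E := E) (F := F)
  pqNorm_circ ξ η hξ hη w :=
    underlyingSeminorm_apply (isPQSeminorm_popSeminorm ι (E := E) (F := F)) ξ η hξ hη w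

end Pop

end PQ

section ProductMeasure

variable {X Y : Type*} [MeasurableSpace X] [MeasurableSpace Y]

/-- `ρ` is a product (cartesian product) of the measures `μ` and `ν`: it is a measure on the product
`σ`-algebra with `ρ (A × B) = μ A * ν B` for all measurable `A`, `B`. -/
def IsProductMeasure (μ : Measure X) (ν : Measure Y) (ρ : Measure (X × Y)) : Prop :=
  ∀ (A : Set X) (B : Set Y), MeasurableSet A → MeasurableSet B → ρ (A ×ˢ B) = μ A * ν B

lemma isProductMeasure_prod (μ : Measure X) (ν : Measure Y) [SFinite ν] :
    IsProductMeasure μ ν (μ.prod ν) :=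
  fun A B _ _ => Measure.prod_prod A B

/-- The smallest product `μ A * ν B` over measurable rectangles `A × B` containing a set. -/
def rectCover (μ : Measure X) (ν : Measure Y) (S : Set (X × Y)) : ℝ≥0∞ :=
  ⨅ (A : Set X) (B : Set Y) (_ : MeasurableSet A) (_ : MeasurableSet B) (_ : S ⊆ A ×ˢ B),
    μ A * ν B

lemma rectCover_le (μ : Measure X) (ν : Measure Y) {S : Set (X × Y)} {A : Set X} {B : Set Y}
    (hA : MeasurableSet A) (hB : MeasurableSet B) (h : S ⊆ A ×ˢ B) :
    rectCover μ ν S ≤ μ A * ν B :=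
  iInf₂_le_of_le A B (iInf₂_le_of_le hA hB (iInf_le_of_le h le_rfl))

lemma le_rectCover (μ : Measure X) (ν : Measure Y) {S : Set (X × Y)} {c : ℝ≥0∞}
    (h : ∀ A B, MeasurableSet A → MeasurableSet B → S ⊆ A ×ˢ B → c ≤ μ A * ν B) :
    c ≤ rectCover μ ν S :=
  le_iInf₂ fun A B => le_iInf₂ fun hA hB => le_iInf fun hS => h A B hA hB hS

lemma rectCover_empty (μ : Measure X) (ν : Measure Y) : rectCover μ ν ∅ = 0 :=
  le_antisymm ((rectCover_le μ ν MeasurableSet.empty MeasurableSet.empty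
    (Set.empty_subset _)).trans (by simp)) zero_le

/-- Every pair of measures has a product measure. -/
lemma exists_isProductMeasure (μ : Measure X) (ν : Measure Y) :
    ∃ ρ, IsProductMeasure μ ν ρ := by
  let m := OuterMeasure.ofFunction (rectCover μ ν) (rectCover_empty μ ν)
  have h1 : ∀ C : Set X, MeasurableSet C → MeasurableSet[m.caratheodory] (Prod.fst ⁻¹' C) := by
    intro C hC
    refine OuterMeasure.ofFunction_caratheodory fun t => ?_
    refine le_rectCover μ ν fun A B hA hB ht => ?_
    have e : μ A * ν B = μ (A ∩ C) * ν B + μ (A \ C) * ν B := by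
      rw [← add_mul, measure_inter_add_sdiff A hC]
    rw [e]
    refine add_le_add (rectCover_le μ ν (hA.inter hC) hB ?_) (rectCover_le μ ν (hA.diff hC) hB ?_)
    · exact fun z hz => ⟨⟨(ht hz.1).1, hz.2⟩, (ht hz.1).2⟩
    · exact fun z hz => ⟨⟨(ht hz.1).1, hz.2⟩, (ht hz.1).2⟩
  have h2 : ∀ C : Set Y, MeasurableSet C → MeasurableSet[m.caratheodory] (Prod.snd ⁻¹' C) := by
    intro C hC
    refine OuterMeasure.ofFunction_caratheodory fun t => ?_
    refine le_rectCover μ ν fun A B hA hB ht => ?_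
    have e : μ A * ν B = μ A * ν (B ∩ C) + μ A * ν (B \ C) := by
      rw [← mul_add, measure_inter_add_sdiff B hC]
    rw [e]
    refine add_le_add (rectCover_le μ ν hA (hB.inter hC) ?_) (rectCover_le μ ν hA (hB.diff hC) ?_)
    · exact fun z hz => ⟨(ht hz.1).1, (ht hz.1).2, hz.2⟩
    · exact fun z hz => ⟨(ht hz.1).1, (ht hz.1).2, hz.2⟩
  have hle : (inferInstance : MeasurableSpace (X × Y)) ≤ m.caratheodory := by
    refine sup_le ?_ ?_
    · rintro _ ⟨C, hC, rfl⟩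
      exact h1 C hC
    · rintro _ ⟨C, hC, rfl⟩
      exact h2 C hC
  refine ⟨m.toMeasure hle, fun A B hA hB => ?_⟩
  rw [toMeasure_apply m hle (hA.prod hB)]
  refine le_antisymm ((OuterMeasure.ofFunction_le _).trans (rectCover_le μ ν hA hB le_rfl)) ?_
  rw [OuterMeasure.ofFunction_apply]
  refine le_iInf₂ fun t ht => ?_
  refine ENNReal.le_of_forall_pos_le_add fun ε hε _ => ?_
  obtain ⟨δ, hδ, hδε⟩ := ENNReal.exists_pos_sum_of_countable (ENNReal.coe_pos.mpr hε).ne' ℕ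
  have hc : ∀ n, ∃ (C : Set X) (D : Set Y), MeasurableSet C ∧ MeasurableSet D ∧ t n ⊆ C ×ˢ D ∧
      μ C * ν D ≤ rectCover μ ν (t n) + δ n := by
    intro n
    by_contra! hcon
    by_cases htop : rectCover μ ν (t n) = ∞
    · exact absurd (hcon Set.univ Set.univ MeasurableSet.univ MeasurableSet.univ (by simp))
        (by simp [htop])
    · have := le_rectCover μ ν (S := t n) (c := rectCover μ ν (t n) + δ n)
        fun C D hC hD hs => (hcon C D hC hD hs).le
      exact absurd this (not_le.mpr (ENNReal.lt_add_right htop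
        (ENNReal.coe_pos.mpr (hδ n)).ne'))
  choose C D hC hD hCD hle' using hc
  calc μ A * ν B = ∫⁻ x, A.indicator (fun _ => ν B) x ∂μ := by
        rw [lintegral_indicator hA]; simp [mul_comm]
    _ ≤ ∫⁻ x, ∑' n, (C n).indicator (fun _ => ν (D n)) x ∂μ := by
        refine lintegral_mono fun x => ?_
        by_cases hx : x ∈ A
        · rw [Set.indicator_of_mem hx]
          calc ν B ≤ ν (⋃ n, {y | x ∈ C n ∧ y ∈ D n}) := by
                refine measure_mono fun y hy => ?_
                obtain ⟨n, hn⟩ := Set.mem_iUnion.mp (ht (show (x, y) ∈ A ×ˢ B from ⟨hx, hy⟩))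
                exact Set.mem_iUnion.mpr ⟨n, (hCD n hn).1, (hCD n hn).2⟩
            _ ≤ ∑' n, ν {y | x ∈ C n ∧ y ∈ D n} := measure_iUnion_le _
            _ ≤ _ := by
                refine ENNReal.tsum_le_tsum fun n => ?_
                by_cases hxn : x ∈ C n <;> simp [hxn]
        · rw [Set.indicator_of_notMem hx]; exact zero_le
    _ = ∑' n, μ (C n) * ν (D n) := by
        rw [lintegral_tsum fun n => (measurable_const.indicator (hC n)).aemeasurable]
        refine tsum_congr fun n => ?_
        rw [lintegral_indicator (hC n)]; simp [mul_comm]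
    _ ≤ ∑' n, (rectCover μ ν (t n) + δ n) := ENNReal.tsum_le_tsum hle'
    _ = ∑' n, rectCover μ ν (t n) + ∑' n, (δ n : ℝ≥0∞) := ENNReal.tsum_add
    _ ≤ _ := by gcongr

end ProductMeasure

end

end ProtoQuantum

open ProtoQuantum

/-! The operator `I` is a complete contraction because of what happens pointwise. For `u` and `v` in
the two amplifications, the function corresponding to `I_∞(u ◇ v)` is `(s, t) ↦ u(s) ◇ v(t)`
(`lpAlpha_lpTensor_popDia`). Its norm is at most `‖u(s)‖ ‖v(t)‖`, which integrates to `‖u‖ ‖v‖`.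
Since the pop norm is an infimum over sums of elements `a · (u ◇ v) · b`, this bound passes to all
of the domain (`norm_ampMap_le_of_popDia`).

The reverse inequality rests on the additivity of the `L₁` norm over disjoint supports. An element
built from simple functions can be written over pairwise disjoint rectangles `C_i × D_i` with
coefficients `w_i` in `𝒦(E ⊗_pop F)` (`exists_disjoint_repr`). Its image is `∑ χ_{C_i × D_i} w_i`,
of norm exactly `∑ μ(C_i) ν(D_i) ‖w_i‖`. The same sum bounds the norm of the element itself, by the
triangle inequality and `norm_ampMap_popIndicator_le`. Such elements are dense, and for a
contraction the reverse inequality is a closed condition.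

The measures need not be σ-finite and `ρ` need not be unique, so Tonelli's theorem is avoided. Only
integrals of products `f(s) g(t)` occur, and the values of `ρ` on rectangles determine these
(`lintegral_mul`). -/

namespace ProtoQuantum

noncomputable section

/-! ### Integration against a product measure, and pointwise bilinear operators on `L₁`. -/

namespace IsProductMeasure

variable {X Y : Type*} [MeasurableSpace X] [MeasurableSpace Y]
  {μ : Measure X} {ν : Measure Y} {ρ : Measure (X × Y)}

/-- If `μ s = 0` then `ρ (s × Y) = 0 * ν Y = 0`, even when `ν Y = ∞`. This is what lets
almost-everywhere statements on a factor be pulled back to `X × Y`. -/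
lemma quasiMeasurePreserving_fst (hρ : IsProductMeasure μ ν ρ) :
    Measure.QuasiMeasurePreserving Prod.fst ρ μ := by
  refine ⟨measurable_fst, Measure.AbsolutelyContinuous.mk fun s hs h0 => ?_⟩
  rw [Measure.map_apply measurable_fst hs, ← Set.prod_univ, hρ _ _ hs MeasurableSet.univ, h0,
    zero_mul]

lemma quasiMeasurePreserving_snd (hρ : IsProductMeasure μ ν ρ) :
    Measure.QuasiMeasurePreserving Prod.snd ρ ν := by
  refine ⟨measurable_snd, Measure.AbsolutelyContinuous.mk fun s hs h0 => ?_⟩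
  rw [Measure.map_apply measurable_snd hs, ← Set.univ_prod, hρ _ _ MeasurableSet.univ hs, h0,
    mul_zero]

/-- Half of a substitute for Tonelli: with the second factor frozen at an indicator, the case of an
indicator `f` is the value of `ρ` on a rectangle, and sums and monotone limits give every measurable
`f`. -/
lemma lintegral_mul_indicator (hρ : IsProductMeasure μ ν ρ) {f : X → ℝ≥0∞} (hf : Measurable f)
    {B : Set Y} (hB : MeasurableSet B) :
    ∫⁻ p, f p.1 * B.indicator 1 p.2 ∂ρ = (∫⁻ s, f s ∂μ) * ν B := by
  have hBm : Measurable fun p : X × Y => B.indicator (1 : Y → ℝ≥0∞) p.2 :=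
    (measurable_one.indicator hB).comp measurable_snd
  have hm : ∀ {f : X → ℝ≥0∞}, Measurable f →
      Measurable fun p : X × Y => f p.1 * B.indicator (1 : Y → ℝ≥0∞) p.2 :=
    fun hf => (hf.comp measurable_fst).mul hBm
  refine Measurable.ennreal_induction
    (motive := fun f => ∫⁻ p, f p.1 * B.indicator 1 p.2 ∂ρ = (∫⁻ s, f s ∂μ) * ν B) ?_ ?_ ?_ hf
  · intro c A hA
    have h : (fun p : X × Y => A.indicator (fun _ => c) p.1 * B.indicator 1 p.2)
        = (A ×ˢ B).indicator fun _ => c := by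
      ext p
      by_cases h1 : p.1 ∈ A <;> by_cases h2 : p.2 ∈ B <;> simp [h1, h2, Set.indicator]
    rw [h, lintegral_indicator_const (hA.prod hB), lintegral_indicator_const hA, hρ A B hA hB,
      mul_assoc]
  · intro f g _ hf hg ihf ihg
    simp only [Pi.add_apply, add_mul]
    rw [lintegral_add_left (hm hf), lintegral_add_left hf, add_mul,
      ihf, ihg]
  · intro f hf hmono ih
    simp only [ENNReal.iSup_mul]
    rw [lintegral_iSup (fun n => hm (hf n)), lintegral_iSup hf hmono,
      ENNReal.iSup_mul]
    · exact iSup_congr ih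
    · exact fun m n hmn p => mul_le_mul_left (hmono hmn p.1) _

/-- The same induction in the second factor, `f` now being arbitrary; `lintegral_mul_indicator` is
the base case. -/
lemma lintegral_mul (hρ : IsProductMeasure μ ν ρ) {f : X → ℝ≥0∞} (hf : Measurable f)
    {g : Y → ℝ≥0∞} (hg : Measurable g) :
    ∫⁻ p, f p.1 * g p.2 ∂ρ = (∫⁻ s, f s ∂μ) * ∫⁻ t, g t ∂ν := by
  have hm : ∀ {g : Y → ℝ≥0∞}, Measurable g → Measurable fun p : X × Y => f p.1 * g p.2 :=
    fun hg => (hf.comp measurable_fst).mul (hg.comp measurable_snd)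
  refine Measurable.ennreal_induction
    (motive := fun g => ∫⁻ p, f p.1 * g p.2 ∂ρ = (∫⁻ s, f s ∂μ) * ∫⁻ t, g t ∂ν) ?_ ?_ ?_ hg
  · intro c B hB
    have h : (fun p : X × Y => f p.1 * B.indicator (fun _ => c) p.2)
        = fun p => (f p.1 * B.indicator 1 p.2) * c := by
      ext p
      by_cases h2 : p.2 ∈ B <;> simp [h2]
    rw [h, lintegral_mul_const _ (hm (measurable_one.indicator hB)),
      hρ.lintegral_mul_indicator hf hB, lintegral_indicator_const hB, mul_assoc, mul_comm c]
  · intro g h _ hg hh ihg ihh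
    simp only [Pi.add_apply, mul_add]
    rw [lintegral_add_left (hm hg), lintegral_add_left hg, mul_add,
      ihg, ihh]
  · intro g hg hmono ih
    simp only [ENNReal.mul_iSup]
    rw [lintegral_iSup (fun n => hm (hg n)), lintegral_iSup hg hmono,
      ENNReal.mul_iSup]
    · exact iSup_congr ih
    · exact fun m n hmn p => mul_le_mul_right (hmono hmn p.2) _

section Bilin

variable {E F G : Type*} [NormedAddCommGroup E] [NormedAddCommGroup F] [NormedAddCommGroup G]

/-- No measurability of `h` is required, so the estimate serves both to show that a function lies in
`L₁` and to bound the norms of its elements. -/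
lemma eLpNorm_le_mul (hρ : IsProductMeasure μ ν ρ) (x : Lp E 1 μ) (y : Lp F 1 ν)
    {h : X × Y → G} (hh : ∀ᵐ p ∂ρ, ‖h p‖ ≤ ‖x p.1‖ * ‖y p.2‖) :
    eLpNorm h 1 ρ ≤ eLpNorm x 1 μ * eLpNorm y 1 ν := by
  simp only [eLpNorm_one_eq_lintegral_enorm]
  rw [← hρ.lintegral_mul (Lp.stronglyMeasurable x).enorm (Lp.stronglyMeasurable y).enorm]
  refine lintegral_mono_ae ?_
  filter_upwards [hh] with p hp
  rw [← ofReal_norm, ← ofReal_norm, ← ofReal_norm,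
    ← ENNReal.ofReal_mul (norm_nonneg _)]
  exact ENNReal.ofReal_le_ofReal hp

lemma norm_le_mul (hρ : IsProductMeasure μ ν ρ) (x : Lp E 1 μ) (y : Lp F 1 ν)
    (z : Lp G 1 ρ) (hz : ∀ᵐ p ∂ρ, ‖z p‖ ≤ ‖x p.1‖ * ‖y p.2‖) : ‖z‖ ≤ ‖x‖ * ‖y‖ := by
  rw [Lp.norm_def, Lp.norm_def, Lp.norm_def, ← ENNReal.toReal_mul]
  exact ENNReal.toReal_mono (ENNReal.mul_ne_top (Lp.eLpNorm_ne_top x) (Lp.eLpNorm_ne_top y))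
    (hρ.eLpNorm_le_mul x y hz)

variable [NormedSpace ℂ E] [NormedSpace ℂ F] [NormedSpace ℂ G]

lemma memLp_bilin (hρ : IsProductMeasure μ ν ρ) (B : E →L[ℂ] F →L[ℂ] G)
    (hB : ∀ x y, ‖B x y‖ ≤ ‖x‖ * ‖y‖) (x : Lp E 1 μ) (y : Lp F 1 ν) :
    MemLp (fun p : X × Y => B (x p.1) (y p.2)) 1 ρ := by
  refine ⟨?_, (hρ.eLpNorm_le_mul x y (.of_forall fun p => hB _ _)).trans_lt
    (ENNReal.mul_lt_top (Lp.eLpNorm_lt_top x) (Lp.eLpNorm_lt_top y))⟩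
  -- The representatives provided by `Lp` are strongly measurable everywhere, not just almost
  -- everywhere, so they may be composed with the projections.
  exact B.aestronglyMeasurable_comp₂
    ((Lp.stronglyMeasurable x).comp_measurable measurable_fst).aestronglyMeasurable
    ((Lp.stronglyMeasurable y).comp_measurable measurable_snd).aestronglyMeasurable

/-- The bilinear operator `L₁(X, E) × L₁(Y, F) → L₁(X × Y, G)` acting pointwise by a contractive
bilinear operator `E × F → G`. -/
def lpBilin (hρ : IsProductMeasure μ ν ρ) (B : E →L[ℂ] F →L[ℂ] G)
    (hB : ∀ x y, ‖B x y‖ ≤ ‖x‖ * ‖y‖) : Lp E 1 μ →ₗ[ℂ] Lp F 1 ν →ₗ[ℂ] Lp G 1 ρ :=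
  LinearMap.mk₂ ℂ (fun x y => (hρ.memLp_bilin B hB x y).toLp _)
    (fun x x' y => by
      rw [← MemLp.toLp_add]
      refine MemLp.toLp_congr _ _ ?_
      -- Additivity of representatives holds only off a null set of `X`, which the projection pulls
      -- back to a `ρ`-null set.
      filter_upwards [hρ.quasiMeasurePreserving_fst.ae (Lp.coeFn_add x x')] with p hp
      simp only [hp, Pi.add_apply, map_add, add_apply])
    (fun c x y => by
      rw [← MemLp.toLp_const_smul]
      refine MemLp.toLp_congr _ _ ?_
      filter_upwards [hρ.quasiMeasurePreserving_fst.ae (Lp.coeFn_smul c x)] with p hp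
      simp only [hp, Pi.smul_apply, map_smul, smul_apply])
    (fun x y y' => by
      rw [← MemLp.toLp_add]
      refine MemLp.toLp_congr _ _ ?_
      filter_upwards [hρ.quasiMeasurePreserving_snd.ae (Lp.coeFn_add y y')] with p hp
      simp only [hp, Pi.add_apply, map_add])
    (fun c x y => by
      rw [← MemLp.toLp_const_smul]
      refine MemLp.toLp_congr _ _ ?_
      filter_upwards [hρ.quasiMeasurePreserving_snd.ae (Lp.coeFn_smul c y)] with p hp
      simp only [hp, Pi.smul_apply, map_smul])

lemma lpBilin_coeFn (hρ : IsProductMeasure μ ν ρ) (B : E →L[ℂ] F →L[ℂ] G)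
    (hB : ∀ x y, ‖B x y‖ ≤ ‖x‖ * ‖y‖) (x : Lp E 1 μ) (y : Lp F 1 ν) :
    hρ.lpBilin B hB x y =ᵐ[ρ] fun p => B (x p.1) (y p.2) :=
  (hρ.memLp_bilin B hB x y).coeFn_toLp

end Bilin

end IsProductMeasure

/-! ### Amplifications and bounds for the pop norm. -/

section Pop

variable {L : Type*} [NormedAddCommGroup L] [InnerProductSpace ℂ L]

section Algebra

variable {E F G : Type*} [AddCommGroup E] [Module ℂ E] [AddCommGroup F] [Module ℂ F]
  [AddCommGroup G] [Module ℂ G]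

lemma ampMap_sandwich (φ : E →ₗ[ℂ] F) (a b : L →L[ℂ] L) (u : Amp L E) :
    ampMap L φ (sandwich a b u) = sandwich a b (ampMap L φ u) := by
  induction u with
  | zero => simp
  | tmul c x => simp
  | add u v hu hv => simp only [map_add, hu, hv]

lemma ampMap_comp_apply {E F G : Type*} [AddCommGroup E] [Module ℂ E] [AddCommGroup F] [Module ℂ F]
    [AddCommGroup G] [Module ℂ G] (φ : F →ₗ[ℂ] G) (ψ : E →ₗ[ℂ] F) (u : Amp L E) :
    ampMap L φ (ampMap L ψ u) = ampMap L (φ ∘ₗ ψ) u := by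
  induction u with
  | zero => simp
  | tmul a x => simp
  | add u v hu hv => simp only [map_add, hu, hv]

/-- Naturality of amplified bilinear operators. It is needed to carry `popIndicator` through `u ◇
v`. -/
lemma ampMap_ampBilin [CompleteSpace L] (ι : HilbertSquare L ≃ₗᵢ[ℂ] L)
    {E' F' G' : Type*} [AddCommGroup E'] [Module ℂ E'] [AddCommGroup F'] [Module ℂ F']
    [AddCommGroup G'] [Module ℂ G'] {B : E →ₗ[ℂ] F →ₗ[ℂ] G} {B' : E' →ₗ[ℂ] F' →ₗ[ℂ] G'}
    {φ : E →ₗ[ℂ] E'} {ψ : F →ₗ[ℂ] F'} {χ : G →ₗ[ℂ] G'}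
    (h : ∀ x y, χ (B x y) = B' (φ x) (ψ y)) (u : Amp L E) (v : Amp L F) :
    ampMap L χ (ampBilin ι B u v) = ampBilin ι B' (ampMap L φ u) (ampMap L ψ v) := by
  induction u with
  | zero => simp
  | add u u' hu hv => simp only [map_add, LinearMap.add_apply, hu, hv]
  | tmul a x =>
    induction v with
    | zero => simp
    | add v v' hu hv => simp only [map_add, hu, hv]
    | tmul b y => simp [h]

end Algebra

lemma PopTensor.linearMap_ext {E F G : Type*} [AddCommGroup E] [Module ℂ E] [AddCommGroup F]
    [Module ℂ F] [AddCommGroup G] [Module ℂ G] [CompleteSpace L] (ι : HilbertSquare L ≃ₗᵢ[ℂ] L)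
    {φ ψ : PopTensor ι E F →ₗ[ℂ] G}
    (h : ∀ x y, φ (PopTensor.tmul ι x y) = ψ (PopTensor.tmul ι x y)) : φ = ψ :=
  TensorProduct.ext' h

@[elab_as_elim]
lemma PopTensor.induction_on {E F : Type*} [AddCommGroup E] [Module ℂ E] [AddCommGroup F]
    [Module ℂ F] [CompleteSpace L] (ι : HilbertSquare L ≃ₗᵢ[ℂ] L) {p : PopTensor ι E F → Prop}
    (w : PopTensor ι E F) (zero : p 0) (tmul : ∀ x y, p (PopTensor.tmul ι x y))
    (add : ∀ w w', p w → p w' → p (w + w')) : p w :=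
  TensorProduct.induction_on (motive := p) w zero tmul add

lemma norm_sum_amp_le {G : Type*} [NormedAddCommGroup G] [NormedSpace ℂ G] [PQSpace L G]
    {κ : Type*} (s : Finset κ) (u : κ → Amp L G) : ‖∑ i ∈ s, u i‖ ≤ ∑ i ∈ s, ‖u i‖ :=
  norm_sum_le s u

/-- A contraction is continuous, so both sides of the reverse inequality are continuous in `u`; it
then suffices to check it on a dense set. -/
lemma isClosed_setOf_norm_le_norm_ampMap {E F : Type*} [NormedAddCommGroup E] [NormedSpace ℂ E]
    [PQSpace L E] [NormedAddCommGroup F] [NormedSpace ℂ F] [PQSpace L F] (φ : E →ₗ[ℂ] F)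
    (h : ∀ u : Amp L E, ‖ampMap L φ u‖ ≤ ‖u‖) :
    IsClosed {u : Amp L E | ‖u‖ ≤ ‖ampMap L φ u‖} :=
  isClosed_le continuous_norm (AddMonoidHomClass.continuous_of_bound (ampMap L φ) 1 fun u =>
    (h u).trans_eq (one_mul _).symm).norm

lemma norm_amp_Lp [CompleteSpace L] {E : Type*} [NormedAddCommGroup E] [NormedSpace ℂ E]
    [PQSpace L E] {X : Type*} [MeasurableSpace X] {μ : Measure X} (u : Amp L (Lp E 1 μ)) :
    ‖u‖ = ‖lpAlpha μ 1 u‖ := rfl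

variable [CompleteSpace L] [Nontrivial L] (ι : HilbertSquare L ≃ₗᵢ[ℂ] L)
  {E F : Type*} [NormedAddCommGroup E] [NormedSpace ℂ E] [PQSpace L E]
  [NormedAddCommGroup F] [NormedSpace ℂ F] [PQSpace L F]

lemma norm_popTensor_def (U : Amp L (PopTensor ι E F)) :
    ‖U‖ = sInf (popSums ι (E := E) (F := F) U) := rfl

/-- The one-term representation with `a = b = 1` competes in the infimum, and the identity has norm
one because `L` is nontrivial. -/
lemma norm_popDia_le (u : Amp L E) (v : Amp L F) :
    ‖ampBilin ι (PopTensor.tmul ι) u v‖ ≤ ‖u‖ * ‖v‖ := by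
  rw [norm_popTensor_def]
  refine csInf_le (popSums_bddBelow ι _) ⟨1, fun _ => ContinuousLinearMap.id ℂ L,
    fun _ => ContinuousLinearMap.id ℂ L, fun _ => u, fun _ => v, ?_, by simp⟩
  have h : ∀ U : Amp L (E ⊗[ℂ] F),
      sandwich (ContinuousLinearMap.id ℂ L) (ContinuousLinearMap.id ℂ L) U = U := by
    intro U
    induction U with
    | zero => simp
    | tmul c x => rw [sandwich_tmul]; rfl
    | add u v hu hv => rw [map_add, hu, hv]
  rw [Fin.sum_univ_one, h]
  rfl

/-- For `Q` of rank one and norm one, `(Q ⊗ x) ◇ (Q ⊗ y) = (Q ◇ Q) ⊗ (x ⊗ y)`, and `Q ◇ Q` is again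
of rank one and norm one, so it computes the underlying norm. -/
lemma norm_popTensor_tmul_le (x : E) (y : F) : ‖PopTensor.tmul ι x y‖ ≤ ‖x‖ * ‖y‖ := by
  have he := norm_unitVec L
  have hee : ‖vecDia ι (unitVec L) (unitVec L)‖ = 1 := by rw [norm_vecDia, he, one_mul]
  have hc : finRankDia ι (circ (unitVec L) (unitVec L)) (circ (unitVec L) (unitVec L))
      = circ (vecDia ι (unitVec L) (unitVec L)) (vecDia ι (unitVec L) (unitVec L)) :=
    Subtype.ext (opDia_rankOne ι _ _ _ _)
  have h := norm_popDia_le ι (Amp.tmul (circ (unitVec L) (unitVec L)) x)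
    (Amp.tmul (circ (unitVec L) (unitVec L)) y)
  rwa [ampBilin_tmul, hc, norm_circ_tmul _ _ hee hee, norm_circ_tmul _ _ he he,
    norm_circ_tmul _ _ he he] at h

/-- The canonical bilinear operator `E × F → E ⊗_pop F`, as a bounded bilinear operator. -/
def PopTensor.tmulCLM : E →L[ℂ] F →L[ℂ] PopTensor ι E F :=
  LinearMap.mkContinuous₂ (PopTensor.tmul ι) 1 fun x y => by
    rw [one_mul]; exact norm_popTensor_tmul_le ι x y

/-- A linear operator on `E ⊗_pop F` is completely bounded as soon as it is bounded on the
elements `u ◇ v`. -/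
lemma norm_ampMap_le_of_popDia {G : Type*} [NormedAddCommGroup G] [NormedSpace ℂ G] [PQSpace L G]
    (φ : PopTensor ι E F →ₗ[ℂ] G) {C : ℝ} (hC : 0 ≤ C)
    (h : ∀ (u : Amp L E) (v : Amp L F),
      ‖ampMap L φ (ampBilin ι (PopTensor.tmul ι) u v)‖ ≤ C * (‖u‖ * ‖v‖))
    (U : Amp L (PopTensor ι E F)) : ‖ampMap L φ U‖ ≤ C * ‖U‖ := by
  rw [norm_popTensor_def, ← smul_eq_mul, ← Real.sInf_smul_of_nonneg hC]
  refine le_csInf ((popSums_nonempty ι (E := E) (F := F) U).smul_set) ?_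
  rintro _ ⟨_, ⟨n, a, b, u, v, hU, rfl⟩, rfl⟩
  have hU' : U = ∑ k, sandwich (a k) (b k) (ampBilin ι (PopTensor.tmul ι) (u k) (v k)) := hU
  simp only [smul_eq_mul]
  rw [hU', map_sum, Finset.mul_sum]
  refine (norm_sum_le _ _).trans (Finset.sum_le_sum fun k _ => ?_)
  -- Amplifications are bimodule maps, and the norm on `𝒦G` is contractive for the bimodule action,
  -- so `‖a k‖` and `‖b k‖` come out as factors.
  rw [ampMap_sandwich]
  calc _ ≤ ‖a k‖ * ‖ampMap L φ (ampBilin ι (PopTensor.tmul ι) (u k) (v k))‖ * ‖b k‖ :=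
        norm_sandwich_le _ _ _
    _ ≤ ‖a k‖ * (C * (‖u k‖ * ‖v k‖)) * ‖b k‖ := by gcongr; exact h _ _
    _ = _ := by ring

end Pop

/-! ### The operator `I` and its complete contractivity. -/

section Integral

variable {L : Type*} [NormedAddCommGroup L] [InnerProductSpace ℂ L] [CompleteSpace L]
  [Nontrivial L] (ι : HilbertSquare L ≃ₗᵢ[ℂ] L)
  {X Y : Type*} [MeasurableSpace X] [MeasurableSpace Y]
  {μ : Measure X} {ν : Measure Y} {ρ : Measure (X × Y)}
  {E F : Type*} [NormedAddCommGroup E] [NormedSpace ℂ E] [PQSpace L E]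
  [NormedAddCommGroup F] [NormedSpace ℂ F] [PQSpace L F]

/-- The operator `L₁(X, E) ⊗_pop L₁(Y, F) → L₁(X × Y, E ⊗_pop F)` taking `x ⊗ y` to the function
`(s, t) ↦ x(s) ⊗ y(t)`. -/
def lpTensor (hρ : IsProductMeasure μ ν ρ) :
    PopTensor ι (Lp E 1 μ) (Lp F 1 ν) →ₗ[ℂ] Lp (PopTensor ι E F) 1 ρ :=
  TensorProduct.lift (hρ.lpBilin (PopTensor.tmulCLM ι) (norm_popTensor_tmul_le ι))

lemma lpTensor_tmul_coeFn (hρ : IsProductMeasure μ ν ρ) (x : Lp E 1 μ) (y : Lp F 1 ν) :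
    lpTensor ι hρ (PopTensor.tmul ι x y) =ᵐ[ρ] fun p => PopTensor.tmul ι (x p.1) (y p.2) := by
  have h : lpTensor ι hρ (PopTensor.tmul ι x y)
      = hρ.lpBilin (PopTensor.tmulCLM ι) (norm_popTensor_tmul_le ι) x y :=
    TensorProduct.lift.tmul x y
  rw [h]
  exact hρ.lpBilin_coeFn _ _ x y

/-- Both sides are bilinear in `(u, v)`, so elementary tensors decide; each step of the two
inductions discards only finitely many null sets. -/
lemma lpAlpha_lpTensor_popDia (hρ : IsProductMeasure μ ν ρ) (u : Amp L (Lp E 1 μ))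
    (v : Amp L (Lp F 1 ν)) :
    lpAlpha ρ 1 (ampMap L (lpTensor ι hρ) (ampBilin ι (PopTensor.tmul ι) u v)) =ᵐ[ρ]
      fun p => ampBilin ι (PopTensor.tmul ι) (lpAlpha μ 1 u p.1) (lpAlpha ν 1 v p.2) := by
  have hfst : ∀ {P : X → Prop}, (∀ᵐ s ∂μ, P s) → ∀ᵐ p ∂ρ, P p.1 :=
    fun h => hρ.quasiMeasurePreserving_fst.ae h
  have hsnd : ∀ {P : Y → Prop}, (∀ᵐ s ∂ν, P s) → ∀ᵐ p ∂ρ, P p.2 :=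
    fun h => hρ.quasiMeasurePreserving_snd.ae h
  induction u with
  | zero =>
    simp only [map_zero, LinearMap.zero_apply]
    filter_upwards [Lp.coeFn_zero (Amp L (PopTensor ι E F)) 1 ρ,
      hfst (Lp.coeFn_zero (Amp L E) 1 μ)] with p h1 h2
    rw [h1, h2]
    simp
  | add u u' hu hu' =>
    simp only [map_add, LinearMap.add_apply]
    filter_upwards [hu, hu', Lp.coeFn_add
      (lpAlpha ρ 1 (ampMap L (lpTensor ι hρ) (ampBilin ι (PopTensor.tmul ι) u v)))
      (lpAlpha ρ 1 (ampMap L (lpTensor ι hρ) (ampBilin ι (PopTensor.tmul ι) u' v))),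
      hfst (Lp.coeFn_add (lpAlpha μ 1 u) (lpAlpha μ 1 u'))] with p h1 h2 h3 h4
    rw [h3, h4, Pi.add_apply, Pi.add_apply, h1, h2, map_add, LinearMap.add_apply]
  | tmul a x =>
    induction v with
    | zero =>
      simp only [map_zero]
      filter_upwards [Lp.coeFn_zero (Amp L (PopTensor ι E F)) 1 ρ,
        hsnd (Lp.coeFn_zero (Amp L F) 1 ν)] with p h1 h2
      rw [h1, h2]
      simp
    | add v v' hu hu' =>
      simp only [map_add]
      filter_upwards [hu, hu', Lp.coeFn_add
        (lpAlpha ρ 1 (ampMap L (lpTensor ι hρ) (ampBilin ι (PopTensor.tmul ι) (Amp.tmul a x) v)))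
        (lpAlpha ρ 1 (ampMap L (lpTensor ι hρ) (ampBilin ι (PopTensor.tmul ι) (Amp.tmul a x) v'))),
        hsnd (Lp.coeFn_add (lpAlpha ν 1 v) (lpAlpha ν 1 v'))] with p h1 h2 h3 h4
      rw [h3, h4, Pi.add_apply, Pi.add_apply, h1, h2, map_add]
    | tmul b y =>
      rw [ampBilin_tmul, ampMap_tmul]
      filter_upwards [lpAlpha_tmul_coeFn ρ 1 (finRankDia ι a b)
          (lpTensor ι hρ (PopTensor.tmul ι x y)), lpTensor_tmul_coeFn ι hρ x y,
        hfst (lpAlpha_tmul_coeFn μ 1 a x), hsnd (lpAlpha_tmul_coeFn ν 1 b y)] with p h1 h2 h3 h4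
      rw [h1, h2, h3, h4, ampBilin_tmul]

/-- Elements `u ◇ v` suffice, and for these the pointwise bound `‖u(s) ◇ v(t)‖ ≤ ‖u(s)‖ ‖v(t)‖` is
integrated. -/
lemma norm_ampMap_lpTensor_le (hρ : IsProductMeasure μ ν ρ)
    (U : Amp L (PopTensor ι (Lp E 1 μ) (Lp F 1 ν))) :
    ‖ampMap L (lpTensor ι hρ) U‖ ≤ ‖U‖ := by
  rw [← one_mul ‖U‖]
  refine norm_ampMap_le_of_popDia ι _ zero_le_one (fun u v => ?_) U
  rw [one_mul, norm_amp_Lp, norm_amp_Lp u, norm_amp_Lp v]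
  refine hρ.norm_le_mul _ _ _ ?_
  filter_upwards [lpAlpha_lpTensor_popDia ι hρ u v] with p hp
  rw [hp]
  exact norm_popDia_le ι _ _

end Integral

/-! ### Vector-valued simple functions in `L₁`. -/

section Indicator

variable {X : Type*} [MeasurableSpace X] {μ : Measure X} {A : Set X}
  {G : Type*} [NormedAddCommGroup G] [NormedSpace ℂ G]

open Classical in
/-- The operator `c ↦ χ_A c` from `G` to `L₁(X, G)`, set to zero unless `A` is a measurable set of
finite measure. -/
def indicatorL1 (μ : Measure X) (A : Set X) : G →ₗ[ℂ] Lp G 1 μ :=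
  if h : MeasurableSet A ∧ μ A ≠ ∞ then
    { toFun := fun c => indicatorConstLp 1 h.1 h.2 c
      map_add' := fun c c' => indicatorConstLp_add.symm
      map_smul' := fun r c => by
        apply Lp.ext
        filter_upwards [indicatorConstLp_coeFn (p := 1) (hs := h.1) (hμs := h.2) (c := r • c),
          indicatorConstLp_coeFn (p := 1) (hs := h.1) (hμs := h.2) (c := c),
          Lp.coeFn_smul r (indicatorConstLp 1 h.1 h.2 c)] with s h1 h2 h3
        rw [RingHom.id_apply, h1, h3, Pi.smul_apply, h2]
        by_cases hs : s ∈ A <;> simp [hs] }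
  else 0

lemma indicatorL1_apply (hA : MeasurableSet A) (hμ : μ A ≠ ∞) (c : G) :
    indicatorL1 μ A c = indicatorConstLp 1 hA hμ c := by
  rw [indicatorL1, dif_pos ⟨hA, hμ⟩]
  rfl

lemma indicatorL1_coeFn (hA : MeasurableSet A) (hμ : μ A ≠ ∞) (c : G) :
    indicatorL1 μ A c =ᵐ[μ] A.indicator fun _ => c := by
  rw [indicatorL1_apply hA hμ]
  exact indicatorConstLp_coeFn

lemma norm_indicatorL1 (hA : MeasurableSet A) (hμ : μ A ≠ ∞) (c : G) :
    ‖indicatorL1 μ A c‖ = μ.real A * ‖c‖ := by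
  rw [indicatorL1_apply hA hμ, norm_indicatorConstLp one_ne_zero ENNReal.one_ne_top]
  simp [mul_comm]

lemma coeFn_sum_indicatorL1 {κ : Type*} (s : Finset κ) {S : κ → Set X}
    (hS : ∀ i, MeasurableSet (S i)) (hμ : ∀ i, μ (S i) ≠ ∞) (c : κ → G) :
    (∑ i ∈ s, indicatorL1 μ (S i) (c i) : Lp G 1 μ) =ᵐ[μ]
      fun t => ∑ i ∈ s, (S i).indicator (fun _ => c i) t := by
  classical
  induction s using Finset.induction_on with
  | empty =>
    simp only [Finset.sum_empty]
    exact Lp.coeFn_zero G 1 μ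
  | insert i s hi ih =>
    simp only [Finset.sum_insert hi]
    filter_upwards [ih, indicatorL1_coeFn (hS i) (hμ i) (c i),
      Lp.coeFn_add (indicatorL1 μ (S i) (c i)) (∑ i ∈ s, indicatorL1 μ (S i) (c i))]
      with t h1 h2 h3
    rw [h3, Pi.add_apply, h1, h2]

lemma indicatorL1_biUnion {κ : Type*} (s : Finset κ) {S : κ → Set X}
    (hS : ∀ i, MeasurableSet (S i)) (hμ : ∀ i, μ (S i) ≠ ∞) (hd : Pairwise (Function.onFun Disjoint S)) (c : G) :
    indicatorL1 μ (⋃ i ∈ s, S i) c = ∑ i ∈ s, indicatorL1 μ (S i) c := by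
  apply Lp.ext
  have hfin : μ (⋃ i ∈ s, S i) ≠ ∞ :=
    (measure_biUnion_lt_top s.finite_toSet fun i _ => (hμ i).lt_top).ne
  filter_upwards [coeFn_sum_indicatorL1 s hS hμ fun _ => c,
    indicatorL1_coeFn (s.measurableSet_biUnion fun i _ => hS i) hfin c] with t h1 h2
  rw [h1, h2, Finset.indicator_biUnion s S fun i _ j _ hij => hd hij]

/-- At each point at most one summand is nonzero, so the norm of the sum equals the sum of the norms
pointwise, and integration preserves this. Here `p = 1` makes the triangle inequality an equality.
-/
lemma norm_sum_indicatorL1 {κ : Type*} [Fintype κ] {S : κ → Set X}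
    (hS : ∀ i, MeasurableSet (S i)) (hμ : ∀ i, μ (S i) ≠ ∞) (hd : Pairwise (Function.onFun Disjoint S))
    (c : κ → G) :
    ‖∑ i, indicatorL1 μ (S i) (c i)‖ = ∑ i, μ.real (S i) * ‖c i‖ := by
  classical
  have h : ∀ t, ‖∑ i, (S i).indicator (fun _ => c i) t‖
      = ∑ i, (S i).indicator (fun _ => ‖c i‖) t := by
    intro t
    by_cases ht : ∃ i, t ∈ S i
    · obtain ⟨i, hi⟩ := ht
      have hne : ∀ j, j ≠ i → t ∉ S j := fun j hj htj => Set.disjoint_left.mp (hd hj) htj hi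
      rw [Finset.sum_eq_single i (fun j _ hj => Set.indicator_of_notMem (hne j hj) _) (by simp),
        Finset.sum_eq_single i (fun j _ hj => Set.indicator_of_notMem (hne j hj) _) (by simp),
        Set.indicator_of_mem hi, Set.indicator_of_mem hi]
    · push Not at ht
      simp [ht]
  rw [L1.norm_eq_integral_norm]
  calc _ = ∫ t, ∑ i, (S i).indicator (fun _ => ‖c i‖) t ∂μ := by
        refine integral_congr_ae ?_
        filter_upwards [coeFn_sum_indicatorL1 Finset.univ hS hμ c] with t ht
        rw [ht, h]
    _ = _ := by
        rw [integral_finsetSum]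
        · exact Finset.sum_congr rfl fun i _ => integral_indicator_const _ (hS i)
        · exact fun i _ => (integrable_indicator_iff (hS i)).mpr (integrableOn_const (hμ i))

/-- A finite family of sets of finite measure has a finite disjoint refinement. -/
lemma exists_disjoint_refinement {n : ℕ} (A : Fin n → Set X) (hA : ∀ k, MeasurableSet (A k))
    (hμ : ∀ k, μ (A k) ≠ ∞) :
    ∃ D : Finset (Fin n) → Set X, (∀ T, MeasurableSet (D T)) ∧ (∀ T, μ (D T) ≠ ∞) ∧
      Pairwise (Function.onFun Disjoint D) ∧ ∀ k, A k = ⋃ T ∈ Finset.univ.filter (k ∈ ·), D T := by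
  classical
  -- `D T` is the set of points lying in `A k` for exactly the indices `k ∈ T`. Intersecting with
  -- the union of all `A k` empties the atom `T = ∅`, which could otherwise have infinite measure.
  refine ⟨fun T => (⋂ k, if k ∈ T then A k else (A k)ᶜ) ∩ ⋃ k, A k, fun T => ?_, fun T => ?_,
    fun T T' hT => ?_, fun k => ?_⟩
  · refine (MeasurableSet.iInter fun k => ?_).inter (MeasurableSet.iUnion hA)
    split_ifs
    · exact hA k
    · exact (hA k).compl
  · refine ne_top_of_le_ne_top ?_ (measure_mono Set.inter_subset_right)
    refine ne_top_of_le_ne_top ?_ (measure_iUnion_fintype_le μ A)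
    exact ENNReal.sum_ne_top.mpr fun k _ => hμ k
  · refine Set.disjoint_left.mpr fun s hs hs' => hT (Finset.ext fun k => ?_)
    have h := Set.mem_iInter.mp hs.1 k
    have h' := Set.mem_iInter.mp hs'.1 k
    by_cases h1 : k ∈ T <;> by_cases h2 : k ∈ T' <;> simp_all
  · ext s
    simp only [Finset.mem_filter_univ, Set.mem_iUnion, exists_prop]
    constructor
    · intro hs
      -- The atom containing `s` is indexed by all `j` with `s ∈ A j`.
      refine ⟨Finset.univ.filter (s ∈ A ·), by simpa using hs, Set.mem_iInter.mpr fun j => ?_,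
        Set.mem_iUnion.mpr ⟨k, hs⟩⟩
      by_cases hj : s ∈ A j <;> simp [hj]
    · rintro ⟨T, hk, hs, -⟩
      simpa [hk] using Set.mem_iInter.mp hs k

/-- Consequently the amplified indicator sends `u` to an element of norm `μ(A) ‖u‖`. -/
lemma lpAlpha_indicatorL1 {L : Type*} [NormedAddCommGroup L] [InnerProductSpace ℂ L]
    [CompleteSpace L] [PQSpace L G] (hA : MeasurableSet A) (hμ : μ A ≠ ∞) (u : Amp L G) :
    lpAlpha μ 1 (ampMap L (indicatorL1 μ A) u) = indicatorL1 μ A u := by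
  induction u with
  | zero => simp
  | add u v hu hv => simp only [map_add, hu, hv]
  | tmul a x =>
    apply Lp.ext
    rw [ampMap_tmul]
    filter_upwards [lpAlpha_tmul_coeFn μ 1 a (indicatorL1 μ A x), indicatorL1_coeFn hA hμ x,
      indicatorL1_coeFn hA hμ (Amp.tmul a x : Amp L G)] with s h1 h2 h3
    rw [h1, h2, h3]
    by_cases hs : s ∈ A <;> simp [hs]

end Indicator

/-! ### The lower bound on simple elements, and density. -/

section CompleteIsometry

variable {L : Type*} [NormedAddCommGroup L] [InnerProductSpace ℂ L]
  (ι : HilbertSquare L ≃ₗᵢ[ℂ] L) {X Y : Type*} [MeasurableSpace X] [MeasurableSpace Y]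
  {μ : Measure X} {ν : Measure Y} {ρ : Measure (X × Y)}

/-- The operator `x ⊗ y ↦ χ_A x ⊗ χ_B y`. -/
def popIndicator {E F : Type*} [NormedAddCommGroup E] [NormedSpace ℂ E]
    [NormedAddCommGroup F] [NormedSpace ℂ F] (μ : Measure X) (ν : Measure Y) (A : Set X) (B : Set Y) :
    PopTensor ι E F →ₗ[ℂ] PopTensor ι (Lp E 1 μ) (Lp F 1 ν) :=
  TensorProduct.map (indicatorL1 μ A) (indicatorL1 ν B)

lemma popIndicator_tmul {E F : Type*} [NormedAddCommGroup E] [NormedSpace ℂ E]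
    [NormedAddCommGroup F] [NormedSpace ℂ F] (A : Set X) (B : Set Y) (x : E) (y : F) :
    popIndicator ι μ ν A B (PopTensor.tmul ι x y)
      = PopTensor.tmul ι (indicatorL1 μ A x) (indicatorL1 ν B y) :=
  TensorProduct.map_tmul _ _ x y

/-- The elements `a ⊗ (χ_A x ⊗ χ_B y)` of `𝒦(L₁(X, E) ⊗ L₁(Y, F))`. -/
def simpleTensors (E F : Type*) [NormedAddCommGroup E] [NormedSpace ℂ E]
    [NormedAddCommGroup F] [NormedSpace ℂ F] (μ : Measure X) (ν : Measure Y) :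
    Set (Amp L (PopTensor ι (Lp E 1 μ) (Lp F 1 ν))) :=
  {U | ∃ (a : finRank L) (x : E) (y : F) (A : Set X) (B : Set Y), MeasurableSet A ∧ μ A ≠ ∞ ∧
    MeasurableSet B ∧ ν B ≠ ∞ ∧
    U = Amp.tmul a (PopTensor.tmul ι (indicatorL1 μ A x) (indicatorL1 ν B y))}

/-- An element of `𝒦(L₁(X, E) ⊗ L₁(Y, F))` given by simple functions can be written with pairwise
disjoint rectangles. -/
lemma exists_disjoint_repr {E F : Type*} [NormedAddCommGroup E] [NormedSpace ℂ E]
    [NormedAddCommGroup F] [NormedSpace ℂ F]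
    {U : Amp L (PopTensor ι (Lp E 1 μ) (Lp F 1 ν))}
    (hU : U ∈ Submodule.span ℂ (simpleTensors ι E F μ ν)) :
    ∃ (n : ℕ) (C : Finset (Fin n) → Set X) (D : Finset (Fin n) → Set Y)
      (w : Finset (Fin n) × Finset (Fin n) → Amp L (PopTensor ι E F)),
      (∀ S, MeasurableSet (C S)) ∧ (∀ S, μ (C S) ≠ ∞) ∧ Pairwise (Function.onFun Disjoint C) ∧
      (∀ T, MeasurableSet (D T)) ∧ (∀ T, ν (D T) ≠ ∞) ∧ Pairwise (Function.onFun Disjoint D) ∧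
      U = ∑ i, ampMap L (popIndicator ι μ ν (C i.1) (D i.2)) (w i) := by
  classical
  obtain ⟨n, r, g, rfl⟩ := Submodule.mem_span_set'.mp hU
  choose a x y A B hA hμ hB hν hg using fun k => (g k).2
  obtain ⟨C, hC, hμC, hdC, hAC⟩ := exists_disjoint_refinement A hA hμ
  obtain ⟨D, hD, hνD, hdD, hBD⟩ := exists_disjoint_refinement B hB hν
  -- The coefficient on `C S × D T` collects the terms `k` with `k ∈ S` and `k ∈ T`, those whose
  -- rectangle `A k × B k` is assembled from pieces including this one.
  refine ⟨n, C, D, fun i => ∑ k, if k ∈ i.1 ∧ k ∈ i.2 then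
    r k • Amp.tmul (a k) (PopTensor.tmul ι (x k) (y k)) else 0, hC, hμC, hdC, hD, hνD, hdD, ?_⟩
  simp only [map_sum]
  rw [Finset.sum_comm]
  refine Finset.sum_congr rfl fun k _ => ?_
  rw [hg k]
  -- `indicatorL1` takes no measurability or finiteness proofs as arguments, so the sets can be
  -- rewritten as unions of atoms in place.
  conv_lhs => rw [hAC k, hBD k, indicatorL1_biUnion _ hC hμC hdC, indicatorL1_biUnion _ hD hνD hdD]
  simp only [map_sum, LinearMap.sum_apply, Finset.smul_sum, Finset.sum_filter]
  rw [Fintype.sum_prod_type, Finset.sum_comm]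
  refine Finset.sum_congr rfl fun S _ => ?_
  by_cases hS : k ∈ S
  · refine Finset.sum_congr rfl fun T _ => ?_
    by_cases hT : k ∈ T <;> simp [hS, hT, popIndicator_tmul]
  · simp [hS]

variable [CompleteSpace L] [Nontrivial L]
  {E F : Type*} [NormedAddCommGroup E] [NormedSpace ℂ E] [PQSpace L E]
  [NormedAddCommGroup F] [NormedSpace ℂ F] [PQSpace L F]

/-- By naturality `u ◇ v` goes to `χ_A u ◇ χ_B v`, of norm at most `μ(A) ‖u‖ ν(B) ‖v‖`. This
controls the domain norm, an infimum with no pointwise formula. -/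
lemma norm_ampMap_popIndicator_le {A : Set X} {B : Set Y} (hA : MeasurableSet A)
    (hB : MeasurableSet B) (hμ : μ A ≠ ∞) (hν : ν B ≠ ∞) (U : Amp L (PopTensor ι E F)) :
    ‖ampMap L (popIndicator ι μ ν A B) U‖ ≤ μ.real A * ν.real B * ‖U‖ := by
  refine norm_ampMap_le_of_popDia ι _ (by positivity) (fun u v => ?_) U
  rw [ampMap_ampBilin ι (popIndicator_tmul ι A B)]
  refine (norm_popDia_le ι _ _).trans (le_of_eq ?_)
  rw [norm_amp_Lp, norm_amp_Lp, lpAlpha_indicatorL1 hA hμ, lpAlpha_indicatorL1 hB hν,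
    norm_indicatorL1 hA hμ, norm_indicatorL1 hB hν]
  ring

/-- Pointwise, `χ_A(s) x ⊗ χ_B(t) y = χ_{A × B}(s, t) (x ⊗ y)`. -/
lemma lpTensor_comp_popIndicator (hρ : IsProductMeasure μ ν ρ) {A : Set X} {B : Set Y}
    (hA : MeasurableSet A) (hB : MeasurableSet B) (hμ : μ A ≠ ∞) (hν : ν B ≠ ∞) :
    lpTensor ι hρ ∘ₗ popIndicator ι μ ν A B
      = (indicatorL1 ρ (A ×ˢ B) : PopTensor ι E F →ₗ[ℂ] Lp (PopTensor ι E F) 1 ρ) := by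
  refine PopTensor.linearMap_ext ι fun x y => ?_
  have hAB : ρ (A ×ˢ B) ≠ ∞ := by
    rw [hρ A B hA hB]
    exact ENNReal.mul_ne_top hμ hν
  apply Lp.ext
  rw [LinearMap.comp_apply, popIndicator_tmul]
  filter_upwards [lpTensor_tmul_coeFn ι hρ (indicatorL1 μ A x) (indicatorL1 ν B y),
    indicatorL1_coeFn (hA.prod hB) hAB (PopTensor.tmul ι x y),
    hρ.quasiMeasurePreserving_fst.ae (indicatorL1_coeFn hA hμ x),
    hρ.quasiMeasurePreserving_snd.ae (indicatorL1_coeFn hB hν y)] with p h1 h2 h3 h4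
  rw [h1, h2, h3, h4]
  by_cases hs : p.1 ∈ A <;> by_cases ht : p.2 ∈ B <;> simp [hs, ht, Set.indicator]

/-- Over disjoint rectangles the image has norm exactly `∑ ρ(C_i × D_i) ‖w_i‖`, while the triangle
inequality bounds `‖U‖` by `∑ μ(C_i) ν(D_i) ‖w_i‖`. The two sums agree because `ρ` is a product
measure. -/
lemma norm_le_norm_ampMap_lpTensor_of_mem_span (hρ : IsProductMeasure μ ν ρ)
    {U : Amp L (PopTensor ι (Lp E 1 μ) (Lp F 1 ν))}
    (hU : U ∈ Submodule.span ℂ (simpleTensors ι E F μ ν)) :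
    ‖U‖ ≤ ‖ampMap L (lpTensor ι hρ) U‖ := by
  obtain ⟨n, C, D, w, hC, hμC, hdC, hD, hνD, hdD, rfl⟩ := exists_disjoint_repr ι hU
  have hfin : ∀ i : Finset (Fin n) × Finset (Fin n), ρ (C i.1 ×ˢ D i.2) ≠ ∞ := fun i => by
    rw [hρ _ _ (hC _) (hD _)]
    exact ENNReal.mul_ne_top (hμC _) (hνD _)
  have hdisj : Pairwise (Function.onFun Disjoint fun i : Finset (Fin n) × Finset (Fin n) =>
      C i.1 ×ˢ D i.2) := by
    intro i j hij
    refine Set.disjoint_prod.mpr ?_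
    -- Distinct index pairs differ in some coordinate, and one disjoint coordinate makes the
    -- rectangles disjoint.
    by_cases h : i.1 = j.1
    · exact Or.inr (hdD fun h' => hij (Prod.ext h h'))
    · exact Or.inl (hdC h)
  have himg : lpAlpha ρ 1 (ampMap L (lpTensor ι hρ)
      (∑ i, ampMap L (popIndicator ι μ ν (C i.1) (D i.2)) (w i)))
      = ∑ i, indicatorL1 ρ (C i.1 ×ˢ D i.2) (w i) := by
    rw [map_sum, map_sum]
    refine Finset.sum_congr rfl fun i _ => ?_
    rw [ampMap_comp_apply, lpTensor_comp_popIndicator ι hρ (hC _) (hD _) (hμC _) (hνD _),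
      lpAlpha_indicatorL1 ((hC _).prod (hD _)) (hfin i)]
  have hnorm := norm_sum_indicatorL1 (fun i => (hC i.1).prod (hD i.2)) hfin hdisj w
  rw [← himg, ← norm_amp_Lp] at hnorm
  rw [hnorm]
  refine (norm_sum_amp_le _ _).trans (Finset.sum_le_sum fun i _ => ?_)
  refine (norm_ampMap_popIndicator_le ι (hC _) (hD _) (hμC _) (hνD _) (w i)).trans (le_of_eq ?_)
  rw [measureReal_def, measureReal_def, measureReal_def, hρ _ _ (hC _) (hD _), ENNReal.toReal_mul]

lemma continuousConstSMul_amp_popTensor :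
    ContinuousConstSMul ℂ (Amp L (PopTensor ι E F)) := inferInstance

/-- For fixed `a` the map `(f, g) ↦ a ⊗ (f ⊗ g)` is continuous, and simple functions are dense in
`L₁`; approximating in each variable and taking sums reaches every `U`. -/
lemma dense_span_simpleTensors (U : Amp L (PopTensor ι (Lp E 1 μ) (Lp F 1 ν))) :
    U ∈ closure (Submodule.span ℂ (simpleTensors ι E F μ ν) :
      Set (Amp L (PopTensor ι (Lp E 1 μ) (Lp F 1 ν)))) := by
  have : ContinuousConstSMul ℂ (Amp L (PopTensor ι (Lp E 1 μ) (Lp F 1 ν))) :=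
    continuousConstSMul_amp_popTensor ι
  change U ∈ (Submodule.span ℂ (simpleTensors ι E F μ ν)).topologicalClosure
  set S := (Submodule.span ℂ (simpleTensors ι E F μ ν)).topologicalClosure
  have hcl : IsClosed (S : Set (Amp L (PopTensor ι (Lp E 1 μ) (Lp F 1 ν)))) :=
    Submodule.isClosed_topologicalClosure _
  have key : ∀ (a : finRank L) (f : Lp E 1 μ) (g : Lp F 1 ν),
      Amp.tmul a (PopTensor.tmul ι f g) ∈ S := by
    intro a f g
    have hcont : Continuous fun q : Lp E 1 μ × Lp F 1 ν =>
        (tmulCLM a (PopTensor.tmulCLM ι q.1 q.2) :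
          Amp L (PopTensor ι (Lp E 1 μ) (Lp F 1 ν))) := by
      fun_prop
    induction f using Lp.induction ENNReal.one_ne_top with
    | indicatorConst x hA hμ =>
      -- An arbitrary `g` is treated while `f` is still an indicator; the outer induction then
      -- releases `f` with `g` fixed.
      induction g using Lp.induction ENNReal.one_ne_top with
      | indicatorConst y hB hν =>
        refine Submodule.le_topologicalClosure _ (Submodule.subset_span
          ⟨a, x, y, _, _, hA, hμ.ne, hB, hν.ne, ?_⟩)
        rw [indicatorL1_apply hA hμ.ne, indicatorL1_apply hB hν.ne]
        rfl
      | add hf hg _ ihf ihg =>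
        rw [map_add, map_add]
        exact S.add_mem ihf ihg
      | isClosed => exact hcl.preimage (hcont.comp (Continuous.prodMk_right _))
    | add hf hg _ ihf ihg =>
      rw [map_add, LinearMap.add_apply, map_add]
      exact S.add_mem ihf ihg
    | isClosed => exact hcl.preimage (hcont.comp (Continuous.prodMk_left g))
  induction U with
  | zero => exact S.zero_mem
  | add U V hU hV => exact S.add_mem hU hV
  | tmul a w =>
    refine PopTensor.induction_on ι w ?_ (key a) fun w w' hw hw' => ?_
    · rw [map_zero]
      exact S.zero_mem
    · rw [map_add]
      exact S.add_mem hw hw'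

/-- Contractivity is used twice: as one of the two inequalities, and to make the other a closed
condition that extends from the dense span. -/
lemma isCompleteIsometry_lpTensor (hρ : IsProductMeasure μ ν ρ) :
    IsCompleteIsometry L (lpTensor ι hρ :
      PopTensor ι (Lp E 1 μ) (Lp F 1 ν) →ₗ[ℂ] Lp (PopTensor ι E F) 1 ρ) := by
  intro U
  let I : PopTensor ι (Lp E 1 μ) (Lp F 1 ν) →ₗ[ℂ] Lp (PopTensor ι E F) 1 ρ := lpTensor ι hρ
  refine le_antisymm (norm_ampMap_lpTensor_le ι hρ U) ?_
  exact closure_minimal (fun V hV => norm_le_norm_ampMap_lpTensor_of_mem_span ι hρ hV)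
    (isClosed_setOf_norm_le_norm_ampMap I (norm_ampMap_lpTensor_le ι hρ))
    (dense_span_simpleTensors ι U)

end CompleteIsometry

end

end ProtoQuantum

theorem theorem6p8
    {L : Type*} [NormedAddCommGroup L] [InnerProductSpace ℂ L] [CompleteSpace L] [Nontrivial L]
    [TopologicalSpace.SeparableSpace L] (hL : ¬ FiniteDimensional ℂ L)
    (ι : HilbertSquare L ≃ₗᵢ[ℂ] L)
    {X Y : Type*} [MeasurableSpace X] [MeasurableSpace Y]
    (μ : Measure X) (ν : Measure Y) (ρ : Measure (X × Y)) (hρ : IsProductMeasure μ ν ρ)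
    {E F : Type*} [NormedAddCommGroup E] [NormedSpace ℂ E] [PQSpace L E]
    [NormedAddCommGroup F] [NormedSpace ℂ F] [PQSpace L F] :
    ∃ I : PopTensor ι (Lp E 1 μ) (Lp F 1 ν) →ₗ[ℂ] Lp (PopTensor ι E F) 1 ρ,
      (∀ (x : Lp E 1 μ) (y : Lp F 1 ν), ∀ᵐ p ∂ρ,
        I (PopTensor.tmul ι x y) p = PopTensor.tmul ι (x p.1) (y p.2)) ∧
      (∀ J : PopTensor ι (Lp E 1 μ) (Lp F 1 ν) →ₗ[ℂ] Lp (PopTensor ι E F) 1 ρ,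
        (∀ (x : Lp E 1 μ) (y : Lp F 1 ν), ∀ᵐ p ∂ρ,
          J (PopTensor.tmul ι x y) p = PopTensor.tmul ι (x p.1) (y p.2)) → J = I) ∧
      IsCompleteIsometry L I := by
  refine ⟨lpTensor ι hρ, lpTensor_tmul_coeFn ι hρ, fun J hJ => ?_,
    isCompleteIsometry_lpTensor ι hρ⟩
  -- Uniqueness: a linear map is determined on elementary tensors, where the almost-everywhere
  -- formula fixes the class in `L₁`.
  refine PopTensor.linearMap_ext ι fun x y => Lp.ext ?_
  filter_upwards [hJ x y, lpTensor_tmul_coeFn ι hρ x y] with p h1 h2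
  rw [h1, h2]
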